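/- For integers $1\le k\le\mu$, a $k$-star on $\mu$ nodes is a graph whose node set consists of $k$ centres and $\mu-k$ leaves such that any two centres are adjacent, no two leaves are adjacent, every leaf is adjacent to exactly one centre, and the numbers of leaves adjacent to any two centres differ by at most one. The graph edit distance between two graphs $g$ and $h$ with the same number of nodes is the minimum number of edge additions and edge deletions that transform $g$ into a graph isomorphic to $h$. There is an algorithm which, given an integer $k\ge 1$ and (by its adjacency matrix) a finite simple graph $g$ with $\mu\ge k$ nodes, computes the graph edit distance between $g$ and a $k$-star on $\mu$ nodes, and which for every fixed $k$ runs in time $O(\mu^{k+2})$, where the constant depends only on $k$. Here the algorithm is a program for a random access machine which executes addition, truncated subtraction, multiplication, integer division, indirect loads and stores, and jumps at unit cost, and which for every fixed $k$ only ever stores numbers of $O(\log\mu)$ bits (that is, numbers bounded by a polynomial in $\mu$). -/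

import Mathlib

/-! ### k-stars -/

/-- `h` is a `k`-star: there are `k` centres, pairwise linked; the remaining nodes (the leaves) are
pairwise not linked; every leaf is linked to exactly one centre; and the numbers of leaves linked to
any two centres differ by at most one. -/
def IsKStar {V : Type*} (k : ℕ) (h : SimpleGraph V) : Prop :=
  ∃ S : Finset V, S.card = k ∧
    (∀ c ∈ S, ∀ d ∈ S, c ≠ d → h.Adj c d) ∧
    (∀ u, u ∉ S → ∀ v, v ∉ S → ¬ h.Adj u v) ∧
    (∀ u, u ∉ S → ∃! c, c ∈ S ∧ h.Adj c u) ∧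
    (∀ c ∈ S, ∀ d ∈ S,
      {u | u ∉ S ∧ h.Adj c u}.ncard ≤ {u | u ∉ S ∧ h.Adj d u}.ncard + 1)

/-- `k`-stars exist on any number `μ ≥ k` of nodes. -/
theorem exists_isKStar {k μ : ℕ} (hk : 1 ≤ k) (hμ : k ≤ μ) :
    ∃ h : SimpleGraph (Fin μ), IsKStar k h := by
  let h : SimpleGraph (Fin μ) := SimpleGraph.fromRel fun i j =>
    (i : ℕ) < k ∧ ((j : ℕ) < k ∨ (j : ℕ) % k = i)
  have hadj : ∀ c u : Fin μ, (c : ℕ) < k → ¬ (u : ℕ) < k → (h.Adj c u ↔ (u : ℕ) % k = c) := by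
    intro c u hc hu
    have : c ≠ u := by rintro rfl; exact hu hc
    simp only [h, SimpleGraph.fromRel_adj]
    tauto
  refine ⟨h, Finset.univ.filter fun i : Fin μ => (i : ℕ) < k, ?_, ?_, ?_, ?_, ?_⟩
  · rw [Fin.card_filter_val_lt]
    omega
  · intro c hc d hd hne
    simp only [Finset.mem_filter, Finset.mem_univ, true_and] at hc hd
    exact ⟨hne, Or.inl ⟨hc, Or.inl hd⟩⟩
  · intro u hu v hv
    simp only [Finset.mem_filter, Finset.mem_univ, true_and] at hu hv
    simp only [h, SimpleGraph.fromRel_adj]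
    tauto
  · intro u hu
    simp only [Finset.mem_filter, Finset.mem_univ, true_and] at hu ⊢
    have hm : (u : ℕ) % k < k := Nat.mod_lt _ hk
    refine ⟨⟨(u : ℕ) % k, hm.trans_le hμ⟩, ⟨hm, (hadj _ _ hm hu).2 rfl⟩, ?_⟩
    rintro c ⟨hc, hcu⟩
    exact Fin.ext ((hadj _ _ hc hu).1 hcu).symm
  · intro c hc d hd
    simp only [Finset.mem_filter, Finset.mem_univ, true_and] at hc hd ⊢
    set A := {u : Fin μ | ¬ (u : ℕ) < k ∧ h.Adj c u}
    set B := {u : Fin μ | ¬ (u : ℕ) < k ∧ h.Adj d u}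
    have key : (A \ {u | (u : ℕ) = c + k}).ncard ≤ B.ncard := by
      have e : ∀ u ∈ A \ {u | (u : ℕ) = c + k}, (u : ℕ) % k = c ∧ c + 2 * k ≤ (u : ℕ) := by
        rintro u ⟨⟨hu, hcu⟩, hne⟩
        have h1 := (hadj _ _ hc hu).1 hcu
        have h2 := Nat.div_add_mod (u : ℕ) k
        refine ⟨h1, ?_⟩
        have h3 : 2 ≤ (u : ℕ) / k := by
          by_contra hlt
          have : (u : ℕ) / k = 0 ∨ (u : ℕ) / k = 1 := by
            generalize (u : ℕ) / k = m at hlt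
            omega
          rcases this with h0 | h0
          · rw [h0] at h2; omega
          · rw [h0] at h2; exact hne (by simp only [Set.mem_ofPred_eq]; omega)
        nlinarith
      refine Set.ncard_le_ncard_of_injOn
        (fun u => if hu : (u : ℕ) - c - k + d < μ then ⟨(u : ℕ) - c - k + d, hu⟩ else u) ?_ ?_
      · intro u hu
        obtain ⟨h1, h2⟩ := e u hu
        have hlt : (u : ℕ) - c - k + d < μ := by omega
        simp only [hlt, dif_pos]
        have hk' : ¬ ((u : ℕ) - c - k + d) < k := by omega
        refine ⟨hk', (hadj _ _ hd hk').2 ?_⟩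
        have h3 := Nat.div_add_mod (u : ℕ) k
        have h4 : (u : ℕ) - c - k + d = d + k * ((u : ℕ) / k - 1) := by
          rw [Nat.mul_sub]; omega
        change ((u : ℕ) - c - k + d) % k = d
        rw [h4, Nat.add_mul_mod_self_left, Nat.mod_eq_of_lt hd]
      · intro u hu v hv huv
        obtain ⟨_, h2⟩ := e u hu
        obtain ⟨_, h4⟩ := e v hv
        have hlt : (u : ℕ) - c - k + d < μ := by omega
        have hlt' : (v : ℕ) - c - k + d < μ := by omega
        simp only [hlt, hlt', dif_pos, Fin.mk.injEq] at huv
        exact Fin.ext (by omega)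
    have h1 : ({u : Fin μ | (u : ℕ) = c + k}).ncard ≤ 1 := by
      rw [Set.ncard_le_one_iff]
      intro a b ha hb
      exact Fin.ext (ha.trans hb.symm)
    have h2 := Set.ncard_le_ncard_sdiff_add_ncard A {u : Fin μ | (u : ℕ) = c + k}
    omega

/-! ### Graph edit distance -/

/-- `g'` arises from `g` by adding one missing link or deleting one existing link. -/
def EditStep {V : Type*} (g g' : SimpleGraph V) : Prop :=
  ∃ u v : V, u ≠ v ∧
    ((¬ g.Adj u v ∧ g' = g ⊔ SimpleGraph.edge u v) ∨
      (g.Adj u v ∧ g' = g \ SimpleGraph.edge u v))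

/-- `EditPath n g g'`: some sequence of exactly `n` link additions and deletions turns `g` into
`g'`. -/
inductive EditPath {V : Type*} : ℕ → SimpleGraph V → SimpleGraph V → Prop
  | refl (g : SimpleGraph V) : EditPath 0 g g
  | step {n : ℕ} {g g' g'' : SimpleGraph V} :
      EditStep g g' → EditPath n g' g'' → EditPath (n + 1) g g''

/-- `d` is the graph edit distance between `g` and `h`: the least number of link additions and
deletions that transform `g` into a graph isomorphic to `h`. -/
def IsGraphEditDistance {V W : Type*} (g : SimpleGraph V) (h : SimpleGraph W) (d : ℕ) : Prop :=
  IsLeast {n : ℕ | ∃ g' : SimpleGraph V, EditPath n g g' ∧ Nonempty (g' ≃g h)} d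

/-! ### Random access machines -/

namespace RAM

/-- Instructions of a random access machine with registers and an indirectly addressed memory. -/
inductive Instr
  /-- `reg a := n` -/
  | const (a n : ℕ)
  /-- `reg a := reg b + reg c` -/
  | add (a b c : ℕ)
  /-- `reg a := reg b - reg c`, which is `0` if `reg b < reg c` -/
  | sub (a b c : ℕ)
  /-- `reg a := reg b * reg c` -/
  | mul (a b c : ℕ)
  /-- `reg a := reg b / reg c`, rounded down, and `0` if `reg c = 0` -/
  | div (a b c : ℕ)
  /-- `reg a := mem (reg b)` -/
  | load (a b : ℕ)
  /-- `mem (reg a) := reg b` -/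
  | store (a b : ℕ)
  /-- go to line `l` -/
  | jmp (l : ℕ)
  /-- go to line `l` if `reg a = 0`, and to the next line otherwise -/
  | jz (a l : ℕ)

/-- A program is a finite list of instructions, on lines `0, 1, 2, …`. -/
abbrev Program := List Instr

/-- A configuration: the current line, the registers, and the memory. -/
structure Config where
  pc : ℕ
  reg : ℕ → ℕ
  mem : ℕ → ℕ

/-- Write `n` to register `a` and go to the next line. -/
def Config.setReg (s : Config) (a n : ℕ) : Config :=
  { s with pc := s.pc + 1, reg := Function.update s.reg a n }

/-- The effect of one instruction. -/
def Instr.exec (s : Config) : Instr → Config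
  | .const a n => s.setReg a n
  | .add a b c => s.setReg a (s.reg b + s.reg c)
  | .sub a b c => s.setReg a (s.reg b - s.reg c)
  | .mul a b c => s.setReg a (s.reg b * s.reg c)
  | .div a b c => s.setReg a (s.reg b / s.reg c)
  | .load a b => s.setReg a (s.mem (s.reg b))
  | .store a b => { s with pc := s.pc + 1, mem := Function.update s.mem (s.reg a) (s.reg b) }
  | .jmp l => { s with pc := l }
  | .jz a l => { s with pc := if s.reg a = 0 then l else s.pc + 1 }

/-- All numbers stored in the configuration are at most `B`. -/
def Config.Bounded (s : Config) (B : ℕ) : Prop :=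
  (∀ a, s.reg a ≤ B) ∧ (∀ a, s.mem a ≤ B)

/-- `HaltsIn P B t s f`: started in `s`, the program `P` executes exactly `t` instructions and then
halts (by reaching a line without an instruction) in the configuration `f`, and no number larger
than `B` is stored in any configuration of this run. -/
inductive HaltsIn (P : Program) (B : ℕ) : ℕ → Config → Config → Prop
  | halt {s : Config} : P[s.pc]? = none → s.Bounded B → HaltsIn P B 0 s s
  | step {t : ℕ} {s f : Config} {i : Instr} : P[s.pc]? = some i → s.Bounded B →
      HaltsIn P B t (i.exec s) f → HaltsIn P B (t + 1) s f

open Classical in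
/-- The start configuration on the input `(k, g)`: line `0`, `k` in register `0`, the number `μ` of
nodes in register `1`, the adjacency matrix of `g` stored row by row in the memory cells
`0, …, μ ^ 2 - 1`, and `0` everywhere else. -/
noncomputable def input (k : ℕ) {μ : ℕ} (g : SimpleGraph (Fin μ)) : Config where
  pc := 0
  reg := fun a => if a = 0 then k else if a = 1 then μ else 0
  mem := fun a => if ∃ i j : Fin μ, a = (i : ℕ) * μ + (j : ℕ) ∧ g.Adj i j then 1 else 0

end RAM

/-! The proof combines a combinatorial formula for the distance with a verified compiler for a small
expression language in which that formula is evaluated.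

Every `k`-star on `Fin μ` is the pullback of `starPattern k` along a labelling with prescribed fibre
sizes, and all such labellings give isomorphic graphs (`IsKStar.exists_label`, `IsStarLabel.iso`).
An edit step changes two ordered pairs, so the distance is half the minimum, over these labellings,
of the number of ordered pairs on which `g` and the pullback differ. The star has a fixed number of
links, so this means maximising the common links (`card_diffPairs_add`). For fixed centres these are
the links of `g` among the centres plus one for each leaf that is adjacent in `g` to its own centre
(`card_commonPairs`).

The maximal number of such served leaves equals the minimum, over sets `T` of centres, of the number
of non-centres adjacent to a centre outside `T` plus the total capacity of `T`. One inequality is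
`card_servedLeaves_le_cutCard`; the other, `exists_assignment`, is Hall's theorem with dummy slots.
Trying all `μ ^ k` tuples of centres and all `2 ^ k` sets `T` costs linear time in `μ` per tuple for
fixed `k`, hence order `μ ^ (k + 1)` in total, which leaves a factor `μ` to spare.

On the machine side, `Computes` records value, time and a bound on stored numbers together, for code
on any line and above any stack of temporaries. It is closed under arithmetic, loads and bounded
loops (`Computes.fold`), so correctness and cost follow the structure of the expression. -/

namespace RAM

/-! ### Straight-line reasoning about runs -/

/-- `Steps P B t s f`: the program `P` runs from `s` to `f` in exactly `t` steps, and all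
configurations before `f` are bounded by `B`. -/
inductive Steps (P : Program) (B : ℕ) : ℕ → Config → Config → Prop
  | refl (s : Config) : Steps P B 0 s s
  | step {t : ℕ} {s f : Config} {i : Instr} : P[s.pc]? = some i → s.Bounded B →
      Steps P B t (i.exec s) f → Steps P B (t + 1) s f

theorem Steps.trans {P : Program} {B t t' : ℕ} {s s' s'' : Config} (h : Steps P B t s s')
    (h' : Steps P B t' s' s'') : Steps P B (t + t') s s'' := by
  induction h with
  | refl s => simpa using h'
  | step hi hb _ ih =>
    rw [Nat.add_right_comm]
    exact .step hi hb (ih h')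

theorem Steps.haltsIn {P : Program} {B t : ℕ} {s f : Config} (h : Steps P B t s f)
    (hf : P[f.pc]? = none) (hb : f.Bounded B) : HaltsIn P B t s f := by
  induction h with
  | refl s => exact .halt hf hb
  | step hi hb' _ ih => exact .step hi hb' (ih hf hb)

/-- The configuration `s` is at line `p`, its memory is `M`, its registers start with `env`, and it
is bounded by `B`. -/
structure State (M : ℕ → ℕ) (B : ℕ) (s : Config) (p : ℕ) (env : List ℕ) : Prop where
  pc : s.pc = p
  mem : s.mem = M
  bounded : s.Bounded B
  reg : ∀ i v, env[i]? = some v → s.reg i = v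

/-- From line `p` with registers `env`, the program reaches line `p'` with registers `env'` within
`T` steps, without storing a number larger than `B` or changing the memory `M`. -/
def Triple (M : ℕ → ℕ) (B : ℕ) (P : Program) (p : ℕ) (env : List ℕ) (T p' : ℕ)
    (env' : List ℕ) : Prop :=
  ∀ s, State M B s p env → ∃ t ≤ T, ∃ s', Steps P B t s s' ∧ State M B s' p' env'

section Triple

variable {M : ℕ → ℕ} {B : ℕ} {P : Program}

theorem Triple.trans {p p' p'' T T' : ℕ} {env env' env'' : List ℕ}
    (h : Triple M B P p env T p' env') (h' : Triple M B P p' env' T' p'' env'') :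
    Triple M B P p env (T + T') p'' env'' := by
  intro s hs
  obtain ⟨t, ht, s', h1, hs'⟩ := h s hs
  obtain ⟨t', ht', s'', h2, hs''⟩ := h' s' hs'
  exact ⟨t + t', Nat.add_le_add ht ht', s'', h1.trans h2, hs''⟩

theorem Triple.mono {p p' T T' : ℕ} {env env' : List ℕ}
    (h : Triple M B P p env T p' env') (hT : T ≤ T') : Triple M B P p env T' p' env' := by
  intro s hs
  obtain ⟨t, ht, r⟩ := h s hs
  exact ⟨t, ht.trans hT, r⟩

/-- A state constrains only an initial segment of the registers, so scratch registers at the end can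
be dropped at no cost. -/
theorem Triple.forget {p p' T : ℕ} {env env' l : List ℕ}
    (h : Triple M B P p env T p' (env' ++ l)) : Triple M B P p env T p' env' := by
  intro s hs
  obtain ⟨t, ht, s', h1, hs'⟩ := h s hs
  refine ⟨t, ht, s', h1, hs'.pc, hs'.mem, hs'.bounded, fun i v hi => hs'.reg i v ?_⟩
  rw [List.getElem?_append_left (List.getElem?_eq_some_iff.1 hi).1, hi]

/-- Register contents are bounded by `B` in every state, so a bound on a listed value may be assumed
for free. -/
theorem Triple.of_le {p p' T i n : ℕ} {env env' : List ℕ} (hi : env[i]? = some n)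
    (h : n ≤ B → Triple M B P p env T p' env') : Triple M B P p env T p' env' :=
  fun s hs => h (hs.reg i n hi ▸ hs.bounded.1 i) s hs

/-- The condition on `env'` lets one lemma cover pushing a value, overwriting one, and discarding
trailing temporaries. -/
theorem State.write {s : Config} {p a v : ℕ} {env env' : List ℕ} (hs : State M B s p env)
    (hv : v ≤ B) (henv : ∀ i w, env'[i]? = some w → i = a ∧ w = v ∨ i ≠ a ∧ env[i]? = some w) :
    State M B (s.setReg a v) (p + 1) env' := by
  refine ⟨by simp [Config.setReg, hs.pc], hs.mem, ⟨fun i => ?_, hs.bounded.2⟩, fun i w hi => ?_⟩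
  · by_cases h : i = a
    · simpa [Config.setReg, h] using hv
    · simpa [Config.setReg, h] using hs.bounded.1 i
  · rcases henv i w hi with ⟨rfl, rfl⟩ | ⟨h, hw⟩
    · simp [Config.setReg]
    · simpa [Config.setReg, h] using hs.reg i w hw

theorem append_write (env : List ℕ) (v i w : ℕ) (h : (env ++ [v])[i]? = some w) :
    i = env.length ∧ w = v ∨ i ≠ env.length ∧ env[i]? = some w := by
  rcases lt_trichotomy i env.length with hi | rfl | hi
  · rw [List.getElem?_append_left hi] at h
    exact .inr ⟨hi.ne, h⟩
  · simp at h
    exact .inl ⟨rfl, h.symm⟩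
  · rw [List.getElem?_eq_none (by simp; omega)] at h
    cases h

theorem set_write (env : List ℕ) (a v i w : ℕ) (h : (env.set a v)[i]? = some w) :
    i = a ∧ w = v ∨ i ≠ a ∧ env[i]? = some w := by
  by_cases hi : i = a
  · subst hi
    rw [List.getElem?_set] at h
    simp only [if_true] at h
    split_ifs at h
    · exact .inl ⟨rfl, (Option.some.inj h).symm⟩
  · rw [List.getElem?_set_ne (Ne.symm hi)] at h
    exact .inr ⟨hi, h⟩

/-- A single instruction that writes the value `v` to register `a`. -/
theorem Triple.write {p a v : ℕ} {i : Instr} {env env' : List ℕ} (hp : P[p]? = some i)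
    (hv : ∀ s, State M B s p env → i.exec s = s.setReg a v ∧ v ≤ B)
    (henv : ∀ i w, env'[i]? = some w → i = a ∧ w = v ∨ i ≠ a ∧ env[i]? = some w) :
    Triple M B P p env 1 (p + 1) env' := by
  intro s hs
  obtain ⟨h1, h2⟩ := hv s hs
  refine ⟨1, le_rfl, s.setReg a v, ?_, hs.write h2 henv⟩
  rw [← h1]
  exact .step (hs.pc ▸ hp) hs.bounded (.refl _)

theorem Triple.jmp {p l : ℕ} {env : List ℕ} (hp : P[p]? = some (.jmp l)) :
    Triple M B P p env 1 l env := by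
  intro s hs
  exact ⟨1, le_rfl, (Instr.jmp l).exec s, .step (hs.pc ▸ hp) hs.bounded (.refl _), rfl, hs.mem,
    hs.bounded, hs.reg⟩

theorem Triple.jz_zero {p a l : ℕ} {env : List ℕ} (hp : P[p]? = some (.jz a l))
    (ha : env[a]? = some 0) : Triple M B P p env 1 l env := by
  intro s hs
  refine ⟨1, le_rfl, (Instr.jz a l).exec s, .step (hs.pc ▸ hp) hs.bounded (.refl _), ?_, hs.mem,
    hs.bounded, hs.reg⟩
  simp [Instr.exec, hs.reg a 0 ha]

theorem Triple.jz_succ {p a l n : ℕ} {env : List ℕ} (hp : P[p]? = some (.jz a l))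
    (ha : env[a]? = some (n + 1)) : Triple M B P p env 1 (p + 1) env := by
  intro s hs
  refine ⟨1, le_rfl, (Instr.jz a l).exec s, .step (hs.pc ▸ hp) hs.bounded (.refl _), ?_, hs.mem,
    hs.bounded, hs.reg⟩
  simp [Instr.exec, hs.reg a _ ha, hs.pc]

end Triple

/-! ### Compiling expressions -/

/-- The list `l` is the part of the program `P` that starts on line `p`. -/
def CodeAt (P : Program) (p : ℕ) (l : Program) : Prop :=
  ∃ l₁ l₂, P = l₁ ++ l ++ l₂ ∧ l₁.length = p

theorem CodeAt.left {P l l' : Program} {p : ℕ} (h : CodeAt P p (l ++ l')) : CodeAt P p l := by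
  obtain ⟨l₁, l₂, rfl, hp⟩ := h
  exact ⟨l₁, l' ++ l₂, by simp, hp⟩

theorem CodeAt.right {P l l' : Program} {p : ℕ} (h : CodeAt P p (l ++ l')) :
    CodeAt P (p + l.length) l' := by
  obtain ⟨l₁, l₂, rfl, rfl⟩ := h
  exact ⟨l₁ ++ l, l₂, by simp, by simp⟩

theorem CodeAt.head {P l : Program} {p : ℕ} {i : Instr} (h : CodeAt P p (i :: l)) :
    P[p]? = some i := by
  obtain ⟨l₁, l₂, rfl, rfl⟩ := h
  simp

theorem CodeAt.tail {P l : Program} {p : ℕ} {i : Instr} (h : CodeAt P p (i :: l)) :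
    CodeAt P (p + 1) l := by
  obtain ⟨l₁, l₂, rfl, rfl⟩ := h
  exact ⟨l₁ ++ [i], l₂, by simp, by simp⟩

/-- A compiled expression: given the number `d` of registers in use and the line `p` on which the
code is placed, the code that computes the value of the expression in register `d`. -/
abbrev Code := ℕ → ℕ → Program

/-- Wherever the registers in use start with `env` and the memory is `M`, the code `c` computes `v`
within `T` steps, without storing a number larger than `B`. -/
def Computes (M : ℕ → ℕ) (B : ℕ) (env : List ℕ) (c : Code) (v T : ℕ) : Prop :=
  ∀ env', env <+: env' → ∀ P p, CodeAt P p (c env'.length p) →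
    Triple M B P p env' T (p + (c env'.length p).length) (env' ++ [v])

namespace Code

/-- The constant `n`. -/
def lit (n : ℕ) : Code := fun d _ => [.const d n]

/-- The content of register `x`. -/
def var (x : ℕ) : Code := fun d _ => [.const d 0, .add d d x]

/-- Evaluate `a` and `b` and combine the results by the instruction `i`. -/
def binary (i : ℕ → ℕ → ℕ → Instr) (a b : Code) : Code := fun d p =>
  a d p ++ (b (d + 1) (p + (a d p).length) ++ [i d d (d + 1)])

/-- Sum. -/
def add : Code → Code → Code := binary .add

/-- Truncated difference. -/
def sub : Code → Code → Code := binary .sub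

/-- Product. -/
def mul : Code → Code → Code := binary .mul

/-- Integer quotient. -/
def div : Code → Code → Code := binary .div

/-- The content of the memory cell with address `a`. -/
def load (a : Code) : Code := fun d p => a d p ++ [.load d d]

/-- The prologue of a loop: the number of rounds, the initial value, and the round index `0`. -/
def foldPrologue (n start : Code) : Code := fun d p =>
  n d p ++ (start (d + 1) (p + (n d p).length) ++ [.const (d + 2) 0])

/-- The loop proper, placed on line `p`. -/
def foldLoop (body : Code → Code → Code) : Code := fun d p =>
  .jz d (p + 1 + (body (var (d + 1)) (var (d + 2)) (d + 3) (p + 1)).length + 6) ::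
    (body (var (d + 1)) (var (d + 2)) (d + 3) (p + 1) ++
      [.const (d + 1) 0, .add (d + 1) (d + 1) (d + 3), .const (d + 3) 1,
        .add (d + 2) (d + 2) (d + 3), .sub d d (d + 3), .jmp p, .add d d (d + 1)])

/-- Start with `start` and apply `body` to the accumulator and the index for the indices
`0, …, n - 1`. -/
def fold (n start : Code) (body : Code → Code → Code) : Code := fun d p =>
  foldPrologue n start d p ++ foldLoop body d (p + (foldPrologue n start d p).length)

end Code

/-! ### Soundness and cost of the compiled code -/

namespace Computes

variable {M : ℕ → ℕ} {B : ℕ} {env : List ℕ}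

theorem extend {env' : List ℕ} {c : Code} {v T : ℕ} (h : Computes M B env c v T)
    (he : env <+: env') : Computes M B env' c v T :=
  fun env'' he' => h env'' (he.trans he')

theorem mono {c : Code} {v T T' : ℕ} (h : Computes M B env c v T) (hT : T ≤ T') :
    Computes M B env c v T' :=
  fun env' he P p hc => (h env' he P p hc).mono hT

theorem lit {n : ℕ} (hn : n ≤ B) : Computes M B env (Code.lit n) n 1 :=
  fun _ _ _ _ hc => .write hc.head (fun _ _ => ⟨rfl, hn⟩) (append_write _ _)

/-- Copying takes two steps: clear the target, then add the source. The source lies strictly below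
the target, so clearing does not destroy it. -/
theorem var {x v : ℕ} (hx : env[x]? = some v) : Computes M B env (Code.var x) v 2 := by
  intro env' he P p hc
  have hx' : env'[x]? = some v := by
    obtain ⟨l, rfl⟩ := he
    rw [List.getElem?_append_left (List.getElem?_eq_some_iff.1 hx).1, hx]
  have hlt : x < env'.length := (List.getElem?_eq_some_iff.1 hx').1
  have h1 : Triple M B P p env' 1 (p + 1) (env' ++ [0]) :=
    .write hc.head (fun _ _ => ⟨rfl, Nat.zero_le _⟩) (append_write _ _)
  refine h1.trans (.write (a := env'.length) (v := v) hc.tail.head (fun s hs => ?_) ?_)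
  · have h2 : s.reg x = v := hs.reg x v (by rw [List.getElem?_append_left hlt, hx'])
    have h3 : s.reg env'.length = 0 := hs.reg _ _ (by simp)
    refine ⟨by simp [Instr.exec, h2, h3], h2 ▸ hs.bounded.1 x⟩
  · intro i w hi
    rcases append_write _ _ _ _ hi with h | ⟨h, h'⟩
    · exact .inl h
    · exact .inr ⟨h, by rw [List.getElem?_append_left (List.getElem?_eq_some_iff.1 h').1, h']⟩

/-- Both operands sit in registers when `i` runs, so `hv` may assume that they are at most `B`. -/
theorem binary {i : ℕ → ℕ → ℕ → Instr} {a b : Code} {va vb v Ta Tb : ℕ}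
    (ha : Computes M B env a va Ta) (hb : Computes M B env b vb Tb)
    (hi : ∀ (s : Config) (d : ℕ), s.reg d = va → s.reg (d + 1) = vb →
      (i d d (d + 1)).exec s = s.setReg d v) (hv : va ≤ B → vb ≤ B → v ≤ B) :
    Computes M B env (Code.binary i a b) v (Ta + Tb + 1) := by
  intro env' he P p hc
  have h1 := ha env' he P p hc.left
  have h2 := hb (env' ++ [va]) (he.trans (List.prefix_append _ _)) P _
    (by simpa using hc.right.left)
  have h3 : Triple M B P (p + (a env'.length p).length +
      (b (env' ++ [va]).length (p + (a env'.length p).length)).length) (env' ++ [va] ++ [vb]) 1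
      (p + (a env'.length p).length +
        (b (env' ++ [va]).length (p + (a env'.length p).length)).length + 1) (env' ++ [v]) := by
    refine .write (a := env'.length) (v := v) (i := i env'.length env'.length (env'.length + 1))
      (by simpa using hc.right.right.head) (fun s hs => ?_) (fun j w hj => ?_)
    · have e1 : s.reg env'.length = va := hs.reg _ _ (by simp)
      have e2 : s.reg (env'.length + 1) = vb := hs.reg _ _ (by simp)
      exact ⟨hi s _ e1 e2, hv (e1 ▸ hs.bounded.1 _) (e2 ▸ hs.bounded.1 _)⟩
    · rcases append_write _ _ _ _ hj with h | ⟨h, h'⟩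
      · exact .inl h
      · refine .inr ⟨h, ?_⟩
        rw [List.append_assoc, List.getElem?_append_left (List.getElem?_eq_some_iff.1 h').1, h']
  convert (h1.trans h2).trans h3 using 1
  simp [Code.binary]
  omega

theorem add {a b : Code} {va vb Ta Tb : ℕ} (ha : Computes M B env a va Ta)
    (hb : Computes M B env b vb Tb) (hv : va ≤ B → vb ≤ B → va + vb ≤ B) :
    Computes M B env (Code.add a b) (va + vb) (Ta + Tb + 1) :=
  binary ha hb (fun s d h h' => by simp [Instr.exec, h, h']) hv

theorem sub {a b : Code} {va vb Ta Tb : ℕ} (ha : Computes M B env a va Ta)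
    (hb : Computes M B env b vb Tb) :
    Computes M B env (Code.sub a b) (va - vb) (Ta + Tb + 1) :=
  binary ha hb (fun s d h h' => by simp [Instr.exec, h, h']) fun h _ => (Nat.sub_le _ _).trans h

theorem mul {a b : Code} {va vb Ta Tb : ℕ} (ha : Computes M B env a va Ta)
    (hb : Computes M B env b vb Tb) (hv : va * vb ≤ B) :
    Computes M B env (Code.mul a b) (va * vb) (Ta + Tb + 1) :=
  binary ha hb (fun s d h h' => by simp [Instr.exec, h, h']) fun _ _ => hv

theorem div {a b : Code} {va vb Ta Tb : ℕ} (ha : Computes M B env a va Ta)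
    (hb : Computes M B env b vb Tb) :
    Computes M B env (Code.div a b) (va / vb) (Ta + Tb + 1) :=
  binary ha hb (fun s d h h' => by simp [Instr.exec, h, h'])
    fun h _ => (Nat.div_le_self _ _).trans h

theorem load {a : Code} {va Ta : ℕ} (ha : Computes M B env a va Ta) :
    Computes M B env (Code.load a) (M va) (Ta + 1) := by
  intro env' he P p hc
  have h1 := ha env' he P p hc.left
  have h2 : Triple M B P (p + (a env'.length p).length) (env' ++ [va]) 1
      (p + (a env'.length p).length + 1) (env' ++ [M va]) := by
    refine .write (a := env'.length) (v := M va) hc.right.head (fun s hs => ?_) ?_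
    · have e1 : s.reg env'.length = va := hs.reg _ _ (by simp)
      exact ⟨by simp [Instr.exec, e1, hs.mem], hs.mem ▸ hs.bounded.2 va⟩
    · intro j w hj
      rcases append_write _ _ _ _ hj with h | ⟨h, h'⟩
      · exact .inl h
      · refine .inr ⟨h, ?_⟩
        rw [List.getElem?_append_left (List.getElem?_eq_some_iff.1 h').1, h']
  convert h1.trans h2 using 1
  simp [Code.load]
  omega

/-- Loop invariant: the three registers after `env` hold the remaining rounds `m`, the accumulator
`A i` and the index `i`, with `i + m = n`. A round costs the body, the test and six bookkeeping
instructions; leaving the loop costs two. -/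
theorem foldLoop {body : Code → Code → Code} {A : ℕ → ℕ} {n Tb : ℕ} {P : Program} {p : ℕ}
    (hB : 1 ≤ B)
    (hc : CodeAt P p (Code.foldLoop body env.length p))
    (hb : ∀ i < n, Computes M B (env ++ [n - i, A i, i])
      (body (Code.var (env.length + 1)) (Code.var (env.length + 2))) (A (i + 1)) Tb)
    (m i : ℕ) (him : i + m = n) (hn : n ≤ B) :
    Triple M B P p (env ++ [m, A i, i]) (m * (Tb + 7) + 2)
      (p + (Code.foldLoop body env.length p).length) (env ++ [A n]) := by
  have ht := hc.tail.right
  induction m generalizing i with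
  | zero =>
    obtain rfl : i = n := by omega
    have h1 : Triple M B P p (env ++ [0, A i, i]) 1 _ (env ++ [0, A i, i]) :=
      .jz_zero hc.head (by simp)
    set q := p + 1 + (body (Code.var (env.length + 1)) (Code.var (env.length + 2))
      (env.length + 3) (p + 1)).length with hq
    -- The exhausted counter is `0`, so a single addition moves the accumulator into the result
    -- register.
    have h2 : Triple M B P (q + 6) (env ++ [0, A i, i]) 1 (q + 6 + 1) (env ++ [A i]) := by
      refine .write (a := env.length) (v := A i) ht.tail.tail.tail.tail.tail.tail.head
        (fun s hs => ?_) (fun j w hj => ?_)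
      · have e1 : s.reg env.length = 0 := hs.reg _ _ (by simp)
        have e2 : s.reg (env.length + 1) = A i := hs.reg _ _ (by simp)
        exact ⟨by simp [Instr.exec, e1, e2], e2 ▸ hs.bounded.1 _⟩
      · rcases append_write _ _ _ _ hj with h | ⟨h, h'⟩
        · exact .inl h
        · refine .inr ⟨h, ?_⟩
          rw [List.getElem?_append_left (List.getElem?_eq_some_iff.1 h').1, h']
    convert h1.trans h2 using 1
    · omega
    · simp [Code.foldLoop, hq]
      omega
  | succ m ih =>
    have h1 : Triple M B P p (env ++ [m + 1, A i, i]) 1 _ (env ++ [m + 1, A i, i]) :=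
      .jz_succ (n := m) hc.head (by simp)
    have e : n - i = m + 1 := by omega
    have h2 := hb i (by omega) _ (List.prefix_refl _) P (p + 1) (by simpa using hc.tail.left)
    rw [e] at h2
    simp only [List.length_append, List.length_cons, List.length_nil, List.append_assoc,
      List.cons_append, List.nil_append] at h2
    set q := p + 1 + (body (Code.var (env.length + 1)) (Code.var (env.length + 2))
      (env.length + 3) (p + 1)).length
    have h3 : Triple M B P q (env ++ [m + 1, A i, i, A (i + 1)]) 1 (q + 1)
        (env ++ [m + 1, 0, i, A (i + 1)]) :=
      .write (a := env.length + 1) ht.head (fun s hs => ⟨rfl, Nat.zero_le _⟩) (by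
        simpa using set_write (env ++ [m + 1, A i, i, A (i + 1)]) (env.length + 1) 0)
    have h4 : Triple M B P (q + 1) (env ++ [m + 1, 0, i, A (i + 1)]) 1 (q + 1 + 1)
        (env ++ [m + 1, A (i + 1), i, A (i + 1)]) := by
      refine .write (a := env.length + 1) (v := A (i + 1)) ht.tail.head (fun s hs => ?_) (by
        simpa using set_write (env ++ [m + 1, 0, i, A (i + 1)]) (env.length + 1) (A (i + 1)))
      have e1 : s.reg (env.length + 1) = 0 := hs.reg _ _ (by simp)
      have e2 : s.reg (env.length + 3) = A (i + 1) := hs.reg _ _ (by simp)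
      exact ⟨by simp [Instr.exec, e1, e2], e2 ▸ hs.bounded.1 _⟩
    have h5 : Triple M B P (q + 1 + 1) (env ++ [m + 1, A (i + 1), i, A (i + 1)]) 1 (q + 1 + 1 + 1)
        (env ++ [m + 1, A (i + 1), i, 1]) :=
      .write (a := env.length + 3) ht.tail.tail.head (fun s hs => ⟨rfl, hB⟩) (by
        simpa using set_write (env ++ [m + 1, A (i + 1), i, A (i + 1)]) (env.length + 3) 1)
    have h6 : Triple M B P (q + 1 + 1 + 1) (env ++ [m + 1, A (i + 1), i, 1]) 1
        (q + 1 + 1 + 1 + 1) (env ++ [m + 1, A (i + 1), i + 1, 1]) := by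
      refine .write (a := env.length + 2) (v := i + 1) ht.tail.tail.tail.head (fun s hs => ?_) (by
        simpa using set_write (env ++ [m + 1, A (i + 1), i, 1]) (env.length + 2) (i + 1))
      have e1 : s.reg (env.length + 2) = i := hs.reg _ _ (by simp)
      have e2 : s.reg (env.length + 3) = 1 := hs.reg _ _ (by simp)
      exact ⟨by simp [Instr.exec, e1, e2], by omega⟩
    have h7 : Triple M B P (q + 1 + 1 + 1 + 1) (env ++ [m + 1, A (i + 1), i + 1, 1]) 1
        (q + 1 + 1 + 1 + 1 + 1) (env ++ [m, A (i + 1), i + 1, 1]) := by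
      refine .write (a := env.length) (v := m) ht.tail.tail.tail.tail.head (fun s hs => ?_) (by
        simpa using set_write (env ++ [m + 1, A (i + 1), i + 1, 1]) env.length m)
      have e1 : s.reg env.length = m + 1 := hs.reg _ _ (by simp)
      have e2 : s.reg (env.length + 3) = 1 := hs.reg _ _ (by simp)
      exact ⟨by simp [Instr.exec, e1, e2], by omega⟩
    have h8 : Triple M B P (q + 1 + 1 + 1 + 1 + 1) (env ++ [m, A (i + 1), i + 1, 1]) 1 p
        (env ++ [m, A (i + 1), i + 1, 1]) := .jmp ht.tail.tail.tail.tail.tail.head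
    have h9 : Triple M B P (q + 1 + 1 + 1 + 1 + 1) (env ++ [m, A (i + 1), i + 1, 1]) 1 p
        (env ++ [m, A (i + 1), i + 1]) := by
      apply Triple.forget (l := [1])
      simpa using h8
    refine ((h1.trans h2).trans (h3.trans (h4.trans (h5.trans (h6.trans (h7.trans
      (h9.trans (ih (i + 1) (by omega))))))))).mono ?_
    rw [Nat.succ_mul]
    omega

/-- The sequence `A` is the trace of the accumulator. The hypothesis on `body` treats accumulator
and index as arbitrary codes, so that no register numbers enter the verification of a loop body. -/
theorem fold {n start : Code} {body : Code → Code → Code} {vn Tn Ti Tb : ℕ} (A : ℕ → ℕ)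
    (hB : 1 ≤ B) (hn : Computes M B env n vn Tn) (hi : Computes M B env start (A 0) Ti)
    (hb : ∀ env' acc idx, env <+: env' → ∀ i < vn, Computes M B env' acc (A i) 2 →
      Computes M B env' idx i 2 → Computes M B env' (body acc idx) (A (i + 1)) Tb) :
    Computes M B env (Code.fold n start body) (A vn) (Tn + Ti + 3 + vn * (Tb + 7)) := by
  intro env' he P p hc
  have h1 := hn env' he P p hc.left.left
  have h2 := hi (env' ++ [vn]) (he.trans (List.prefix_append _ _)) P _
    (by simpa using hc.left.right.left)
  rw [List.length_append, List.length_singleton] at h2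
  have h3 : Triple M B P _ (env' ++ [vn] ++ [A 0]) 1 _ (env' ++ [vn] ++ [A 0] ++ [0]) :=
    .write (a := env'.length + 2) (v := 0) (by simpa using hc.left.right.right.head)
      (fun s hs => ⟨rfl, Nat.zero_le _⟩)
      (by simpa using append_write (env' ++ [vn] ++ [A 0]) 0)
  have h4 : vn ≤ B → _ := fun hvn => foldLoop (env := env') (A := A) (n := vn) (Tb := Tb) hB
    hc.right (fun i hi => hb _ _ _ (he.trans (List.prefix_append _ _)) i hi
      (.var (by simp)) (.var (by simp))) vn 0 (by simp) hvn
  have h5 := Triple.of_le (i := env'.length) (n := vn) (by simp) h4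
  have h6 := (h1.trans h2).trans h3
  simp only [List.append_assoc, List.cons_append, List.nil_append] at h6
  have e : p + (Code.foldPrologue n start env'.length p).length = p + (n env'.length p).length +
      (start (env'.length + 1) (p + (n env'.length p).length)).length + 1 := by
    simp [Code.foldPrologue]
    omega
  rw [e] at h5
  convert h6.trans h5 using 1
  · omega
  · simp only [Code.fold, List.length_append, e]
    omega

end Computes

end RAM

namespace RAM

/-! ### Derived expressions -/

namespace Code

/-- The sum of `f i` over `i < n`. -/
def sum (n : Code) (f : Code → Code) : Code := fold n (lit 0) fun acc i => add acc (f i)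

/-- The power `b ^ n`. -/
def pow (b n : Code) : Code := fold n (lit 1) fun acc _ => mul acc b

/-- The remainder of `a` modulo `b`. -/
def mod (a b : Code) : Code := sub a (mul (div a b) b)

/-- The digit with index `i` of `x` in base `b`. -/
def digit (b x i : Code) : Code := mod (div x (pow b i)) b

/-- `1` if `a = b`, and `0` otherwise. -/
def eqInd (a b : Code) : Code := sub (lit 1) (add (sub a b) (sub b a))

end Code

namespace Computes

variable {M : ℕ → ℕ} {B : ℕ} {env : List ℕ}

theorem sum {n : Code} {f : Code → Code} {vn Tn Tf : ℕ} (F : ℕ → ℕ) (hB : 1 ≤ B)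
    (hn : Computes M B env n vn Tn)
    (hf : ∀ env' idx, env <+: env' → ∀ i < vn, Computes M B env' idx i 2 →
      Computes M B env' (f idx) (F i) Tf)
    (hF : ∑ i ∈ Finset.range vn, F i ≤ B) :
    Computes M B env (Code.sum n f) (∑ i ∈ Finset.range vn, F i)
      (Tn + 4 + vn * (Tf + 10)) := by
  refine (fold (fun m => ∑ i ∈ Finset.range m, F i) (Tb := Tf + 3) hB hn (lit (Nat.zero_le _))
    fun env' acc idx he i hi hacc hidx => ?_).mono (le_of_eq (by ring))
  rw [Finset.sum_range_succ]
  refine (add hacc (hf env' idx he i hi hidx) fun _ _ => ?_).mono (by omega)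
  rw [← Finset.sum_range_succ]
  exact (Finset.sum_le_sum_of_subset (Finset.range_mono hi)).trans hF

theorem pow {b n : Code} {vb vn Tb Tn : ℕ} (hb : Computes M B env b vb Tb)
    (hn : Computes M B env n vn Tn) (hvb : 1 ≤ vb) (hB : vb ^ vn ≤ B) :
    Computes M B env (Code.pow b n) (vb ^ vn) (Tn + 4 + vn * (Tb + 10)) := by
  have h1 : 1 ≤ B := (Nat.one_le_pow _ _ hvb).trans hB
  refine (fold (fun m => vb ^ m) (Tb := Tb + 3) h1 hn (lit h1)
    fun env' acc idx he i hi hacc hidx => ?_).mono (le_of_eq (by ring))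
  refine (mul hacc (hb.extend he) ?_).mono (by omega)
  rw [← pow_succ]
  exact (Nat.pow_le_pow_right hvb hi).trans hB

theorem mod {a b : Code} {va vb Ta Tb : ℕ} (ha : Computes M B env a va Ta)
    (hb : Computes M B env b vb Tb) (hva : va ≤ B) :
    Computes M B env (Code.mod a b) (va % vb) (2 * Ta + 2 * Tb + 3) := by
  have h := (sub ha (mul (div ha hb) hb ((Nat.div_mul_le_self _ _).trans hva))).mono
    (T' := 2 * Ta + 2 * Tb + 3) (by omega)
  rwa [show va - va / vb * vb = va % vb by
    have := Nat.div_add_mod' va vb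
    omega] at h

theorem digit {b x i : Code} {vb vx vi : ℕ} (hb : Computes M B env b vb 2)
    (hx : Computes M B env x vx 2) (hi : Computes M B env i vi 2) (hvb : 1 ≤ vb)
    (hB : vb ^ vi ≤ B) (hvx : vx ≤ B) :
    Computes M B env (Code.digit b x i) (vx / vb ^ vi % vb) (25 + 24 * vi) :=
  (mod (div hx (pow hb hi hvb hB)) hb ((Nat.div_le_self _ _).trans hvx)).mono (by omega)

/-- The two truncated differences add up to the absolute difference, which is `0` exactly in the
case of equality and never exceeds the larger operand. -/
theorem eqInd {a b : Code} {va vb Ta Tb : ℕ} (hB : 1 ≤ B) (ha : Computes M B env a va Ta)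
    (hb : Computes M B env b vb Tb) :
    Computes M B env (Code.eqInd a b) (if va = vb then 1 else 0) (2 * Ta + 2 * Tb + 5) := by
  have h := (sub (lit hB) (add (sub ha hb) (sub hb ha) fun _ _ => by omega)).mono
    (T' := 2 * Ta + 2 * Tb + 5) (by omega)
  rwa [show 1 - (va - vb + (vb - va)) = if va = vb then 1 else 0 by split_ifs <;> omega] at h

end Computes

/-! ### The algorithm -/

/-- The minimum of `a` and the numbers `f i` for `i < n`. -/
def minUpTo (a : ℕ) (f : ℕ → ℕ) : ℕ → ℕ
  | 0 => a
  | n + 1 => min (minUpTo a f n) (f n)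

theorem minUpTo_le_start (a : ℕ) (f : ℕ → ℕ) (n : ℕ) : minUpTo a f n ≤ a := by
  induction n with
  | zero => exact le_rfl
  | succ n ih => exact (min_le_left _ _).trans ih

theorem minUpTo_le (a : ℕ) (f : ℕ → ℕ) {n i : ℕ} (hi : i < n) : minUpTo a f n ≤ f i := by
  induction n with
  | zero => omega
  | succ n ih =>
    rcases Nat.lt_succ_iff_lt_or_eq.1 hi with h | rfl
    · exact (min_le_left _ _).trans (ih h)
    · exact min_le_right _ _

theorem le_minUpTo {a m : ℕ} {f : ℕ → ℕ} {n : ℕ} (ha : m ≤ a) (hf : ∀ i < n, m ≤ f i) :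
    m ≤ minUpTo a f n := by
  induction n with
  | zero => exact ha
  | succ n ih => exact le_min (ih fun i hi => hf i (hi.trans n.lt_succ_self)) (hf n n.lt_succ_self)

/-- The number of leaves that centre `j` gets in a `k`-star on `μ` nodes. -/
def capacity (k μ j : ℕ) : ℕ := (μ - k) / k + (1 - (j + 1 - (μ - k) % k))

/-- The digit with index `i` of `x` in base `b`. -/
def dig (b x i : ℕ) : ℕ := x / b ^ i % b

/-- How many of the centres encoded by `x` are equal to `u`. -/
def memberCount (k μ x u : ℕ) : ℕ := ∑ j ∈ Finset.range k, if u = dig μ x j then 1 else 0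

/-- The number of links from `u` to centres whose index is not in the set encoded by `T`. -/
def hitCount (M : ℕ → ℕ) (k μ x T u : ℕ) : ℕ :=
  ∑ j ∈ Finset.range k, (1 - dig 2 T j) * M (u * μ + dig μ x j)

/-- The capacity of the cut encoded by `T`. -/
def cutValue (M : ℕ → ℕ) (k μ x T : ℕ) : ℕ :=
  ∑ u ∈ Finset.range μ, (1 - memberCount k μ x u) * (1 - (1 - hitCount M k μ x T u)) +
    ∑ j ∈ Finset.range k, dig 2 T j * capacity k μ j

/-- The minimal capacity of a cut, which is the maximal number of leaves that can be served by an
adjacent centre. -/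
def minCut (M : ℕ → ℕ) (k μ x : ℕ) : ℕ := minUpTo μ (cutValue M k μ x) (2 ^ k)

/-- The number of collisions among the centres encoded by `x`. -/
def collisions (k μ x : ℕ) : ℕ :=
  ∑ i ∈ Finset.range k, ∑ j ∈ Finset.range i, if dig μ x i = dig μ x j then 1 else 0

/-- Twice the number of links among the centres encoded by `x`. -/
def innerCount (M : ℕ → ℕ) (k μ x : ℕ) : ℕ :=
  ∑ i ∈ Finset.range k, ∑ j ∈ Finset.range k, M (dig μ x i * μ + dig μ x j)

/-- Twice the maximal number of links that the graph shares with a `k`-star with the centres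
encoded by `x`, or `0` if these are not distinct. -/
def score (M : ℕ → ℕ) (k μ x : ℕ) : ℕ :=
  (1 - collisions k μ x) * (innerCount M k μ x + 2 * minCut M k μ x)

/-- The maximal score. -/
def bestScore (M : ℕ → ℕ) (k μ : ℕ) : ℕ := (Finset.range (μ ^ k)).sup (score M k μ)

/-- The value computed by the algorithm. -/
def starDistance (M : ℕ → ℕ) (k μ : ℕ) : ℕ :=
  (∑ a ∈ Finset.range (μ * μ), M a + k * (k - 1) + 2 * (μ - k) - 2 * bestScore M k μ) / 2

/-! ### The algorithm as code -/

namespace Code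

/-- Code for `capacity`. -/
def capacity (k μ j : Code) : Code :=
  add (div (sub μ k) k) (sub (lit 1) (sub (add j (lit 1)) (mod (sub μ k) k)))

/-- Code for `memberCount`. -/
def memberCount (k μ x u : Code) : Code := sum k fun j => eqInd u (digit μ x j)

/-- Code for `hitCount`. -/
def hitCount (k μ x T u : Code) : Code :=
  sum k fun j => mul (sub (lit 1) (digit (lit 2) T j)) (load (add (mul u μ) (digit μ x j)))

/-- Code for `cutValue`. -/
def cutValue (k μ x T : Code) : Code :=
  add (sum μ fun u =>
      mul (sub (lit 1) (memberCount k μ x u)) (sub (lit 1) (sub (lit 1) (hitCount k μ x T u))))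
    (sum k fun j => mul (digit (lit 2) T j) (capacity k μ j))

/-- Code for `minCut`. -/
def minCut (k μ x : Code) : Code :=
  fold (pow (lit 2) k) μ fun acc T => sub acc (sub acc (cutValue k μ x T))

/-- Code for `collisions`. -/
def collisions (k μ x : Code) : Code :=
  sum k fun i => sum i fun j => eqInd (digit μ x i) (digit μ x j)

/-- Code for `innerCount`. -/
def innerCount (k μ x : Code) : Code :=
  sum k fun i => sum k fun j => load (add (mul (digit μ x i) μ) (digit μ x j))

/-- Code for `score`. -/
def score (k μ x : Code) : Code :=
  mul (sub (lit 1) (collisions k μ x)) (add (innerCount k μ x) (mul (lit 2) (minCut k μ x)))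

/-- Code for `bestScore`. -/
def bestScore (k μ : Code) : Code :=
  fold (pow μ k) (lit 0) fun acc x => add (sub acc (score k μ x)) (score k μ x)

/-- Code for `starDistance`. -/
def starDistance (k μ : Code) : Code :=
  div (sub (add (add (sum (mul μ μ) load) (mul k (sub k (lit 1)))) (mul (lit 2) (sub μ k)))
    (mul (lit 2) (bestScore k μ))) (lit 2)

end Code

/-! ### Bounds for the values -/

section Bounds

variable {M : ℕ → ℕ} {k μ : ℕ}

theorem dig_lt {b : ℕ} (hb : 0 < b) (x i : ℕ) : dig b x i < b := Nat.mod_lt _ hb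

theorem sum_range_le_mul {n m : ℕ} {f : ℕ → ℕ} (h : ∀ i < n, f i ≤ m) :
    ∑ i ∈ Finset.range n, f i ≤ n * m := by
  simpa using Finset.sum_le_card_nsmul (Finset.range n) f m fun i hi => h i (Finset.mem_range.1 hi)

theorem address_lt {u v : ℕ} (hu : u < μ) (hv : v < μ) : u * μ + v < μ * μ := by
  nlinarith

theorem memberCount_le (x u : ℕ) : memberCount k μ x u ≤ k := by
  exact (sum_range_le_mul (m := 1) fun i _ => by split_ifs <;> omega).trans_eq (mul_one k)

theorem hitCount_le (hM : ∀ a, M a ≤ 1) (x T u : ℕ) : hitCount M k μ x T u ≤ k := by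
  exact (sum_range_le_mul (m := 1)
    fun i _ => Nat.mul_le_mul (Nat.sub_le 1 _) (hM _)).trans_eq (mul_one k)

theorem capacity_le (j : ℕ) : capacity k μ j ≤ (μ - k) / k + 1 := by
  unfold capacity
  omega

theorem free_le (T x : ℕ) : ∑ u ∈ Finset.range μ,
    (1 - memberCount k μ x u) * (1 - (1 - hitCount M k μ x T u)) ≤ μ := by
  simpa using sum_range_le_mul (n := μ) (m := 1)
    (f := fun u => (1 - memberCount k μ x u) * (1 - (1 - hitCount M k μ x T u)))
    fun i _ => Nat.mul_le_mul (Nat.sub_le 1 _) (Nat.sub_le 1 _)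

/-- With `q = (μ - k) / k`, every capacity is at most `q + 1`, and `k * (q + 1) ≤ (μ - k) + k`. -/
theorem used_le (hkμ : k ≤ μ) (T : ℕ) :
    ∑ j ∈ Finset.range k, dig 2 T j * capacity k μ j ≤ μ := by
  refine (sum_range_le_mul (m := (μ - k) / k + 1) fun j _ => ?_).trans ?_
  · calc dig 2 T j * capacity k μ j ≤ 1 * ((μ - k) / k + 1) :=
        Nat.mul_le_mul (Nat.lt_succ_iff.1 (dig_lt two_pos _ _)) (capacity_le j)
      _ = _ := one_mul _
  · have := Nat.mul_div_le (μ - k) k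
    rw [mul_add]
    omega

theorem collisions_le (x : ℕ) : collisions k μ x ≤ k * k := by
  refine sum_range_le_mul fun i hi => ?_
  refine (sum_range_le_mul (m := 1) fun j _ => by split_ifs <;> omega).trans (by omega)

theorem innerCount_le (hM : ∀ a, M a ≤ 1) (x : ℕ) : innerCount M k μ x ≤ k * k := by
  refine sum_range_le_mul fun i hi => ?_
  exact (sum_range_le_mul (m := 1) fun j _ => hM _).trans (by omega)

theorem minCut_le (x : ℕ) : minCut M k μ x ≤ μ := minUpTo_le_start _ _ _

theorem score_le (hM : ∀ a, M a ≤ 1) (x : ℕ) : score M k μ x ≤ k * k + 2 * μ := by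
  have h1 := innerCount_le (k := k) (μ := μ) hM x
  have h2 := minCut_le (M := M) (k := k) (μ := μ) x
  calc score M k μ x ≤ 1 * (innerCount M k μ x + 2 * minCut M k μ x) :=
        Nat.mul_le_mul_right _ (Nat.sub_le 1 _)
    _ ≤ _ := by omega

theorem bestScore_le (hM : ∀ a, M a ≤ 1) : bestScore M k μ ≤ k * k + 2 * μ :=
  Finset.sup_le fun x _ => score_le hM x

end Bounds

/-! ### Correctness and running time of the code -/

/-- In the environment `env`, the codes `ck` and `cμ` give `k` and `μ`, and `B` bounds the numbers
that occur in the algorithm. -/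
structure Context (M : ℕ → ℕ) (B : ℕ) (env : List ℕ) (ck cμ : Code) (k μ : ℕ) : Prop where
  k_pos : 1 ≤ k
  k_le : k ≤ μ
  mem_le : ∀ a, M a ≤ 1
  sq_le : 6 * (μ * μ) ≤ B
  pow_le : μ ^ k ≤ B
  two_pow_le : 2 ^ k ≤ B
  computes_k : Computes M B env ck k 2
  computes_μ : Computes M B env cμ μ 2

namespace Context

variable {M : ℕ → ℕ} {B : ℕ} {env : List ℕ} {ck cμ : Code} {k μ : ℕ}

theorem extend {env' : List ℕ} (h : Context M B env ck cμ k μ) (he : env <+: env') :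
    Context M B env' ck cμ k μ :=
  { h with
    computes_k := h.computes_k.extend he
    computes_μ := h.computes_μ.extend he }

theorem μ_pos (h : Context M B env ck cμ k μ) : 1 ≤ μ := h.k_pos.trans h.k_le

theorem μ_le_sq (h : Context M B env ck cμ k μ) : μ ≤ μ * μ := Nat.le_mul_of_pos_left _ h.μ_pos

theorem k_sq_le (h : Context M B env ck cμ k μ) : k * k ≤ μ * μ := Nat.mul_le_mul h.k_le h.k_le

theorem one_le (h : Context M B env ck cμ k μ) : 1 ≤ B := by
  have := h.sq_le
  have := h.μ_pos
  have := h.μ_le_sq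
  omega

theorem two_le (h : Context M B env ck cμ k μ) : 2 ≤ B := by
  have := h.sq_le
  have := h.μ_pos
  have := h.μ_le_sq
  omega

theorem node {cx cj : Code} {x j : ℕ} (h : Context M B env ck cμ k μ)
    (hx : Computes M B env cx x 2) (hxB : x ≤ B) (hj : Computes M B env cj j 2) (hjk : j < k) :
    Computes M B env (Code.digit cμ cx cj) (dig μ x j) (25 + 24 * k) :=
  (Computes.digit h.computes_μ hx hj h.μ_pos
    ((Nat.pow_le_pow_right h.μ_pos hjk.le).trans h.pow_le) hxB).mono (by omega)

theorem bit {cT cj : Code} {T j : ℕ} (h : Context M B env ck cμ k μ)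
    (hT : Computes M B env cT T 2) (hTB : T ≤ B) (hj : Computes M B env cj j 2) (hjk : j < k) :
    Computes M B env (Code.digit (Code.lit 2) cT cj) (dig 2 T j) (25 + 24 * k) :=
  (Computes.digit ((Computes.lit h.two_le).mono one_le_two) hT hj one_le_two
    ((Nat.pow_le_pow_right two_pos hjk.le).trans h.two_pow_le) hTB).mono (by omega)

theorem capacity {cj : Code} {j : ℕ} (h : Context M B env ck cμ k μ)
    (hj : Computes M B env cj j 2) (hjk : j < k) :
    Computes M B env (Code.capacity ck cμ cj) (capacity k μ j) 40 := by
  have h1 := h.sq_le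
  have h2 := h.μ_le_sq
  have h3 := h.k_le
  have h4 := Nat.div_le_self (μ - k) k
  have hd := Computes.sub h.computes_μ h.computes_k
  exact (Computes.add (Computes.div hd h.computes_k)
    (Computes.sub (Computes.lit h.one_le) (Computes.sub
      (Computes.add hj (Computes.lit h.one_le) fun _ _ => by omega)
      (Computes.mod hd h.computes_k (by omega)))) fun _ _ => by omega).mono (by omega)

theorem memberCount {cx cu : Code} {x u : ℕ} (h : Context M B env ck cμ k μ)
    (hx : Computes M B env cx x 2) (hxB : x ≤ B) (hu : Computes M B env cu u 2) :
    Computes M B env (Code.memberCount ck cμ cx cu) (memberCount k μ x u)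
      (6 + k * (69 + 48 * k)) := by
  have h1 := h.sq_le
  have h2 := h.μ_le_sq
  have h3 := h.k_le
  refine (Computes.sum _ (Tf := 59 + 48 * k) h.one_le h.computes_k
    (fun env' idx he j hj hidx => ?_) ?_).mono (le_of_eq (by ring))
  · exact (Computes.eqInd h.one_le (hu.extend he)
      ((h.extend he).node (hx.extend he) hxB hidx hj)).mono (by omega)
  · exact (memberCount_le x u).trans (by omega)

theorem hitCount {cx cT cu : Code} {x T u : ℕ} (h : Context M B env ck cμ k μ)
    (hx : Computes M B env cx x 2) (hxB : x ≤ B) (hT : Computes M B env cT T 2) (hTB : T ≤ B)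
    (hu : Computes M B env cu u 2) (huμ : u < μ) :
    Computes M B env (Code.hitCount ck cμ cx cT cu) (hitCount M k μ x T u)
      (6 + k * (70 + 48 * k)) := by
  have h1 := h.sq_le
  have h2 := h.μ_le_sq
  have h3 := h.k_le
  refine (Computes.sum _ (Tf := 60 + 48 * k) h.one_le h.computes_k
    (fun env' idx he j hj hidx => ?_) ?_).mono (le_of_eq (by ring))
  · have hc := h.extend he
    have ha := address_lt huμ (dig_lt (b := μ) h.μ_pos x j)
    refine (Computes.mul
      (Computes.sub (Computes.lit h.one_le) (hc.bit (hT.extend he) hTB hidx hj))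
      (Computes.load (Computes.add (Computes.mul (hu.extend he) hc.computes_μ ?_)
        (hc.node (hx.extend he) hxB hidx hj) fun _ _ => ?_)) ?_).mono (by omega)
    · omega
    · omega
    · exact (Nat.mul_le_mul (Nat.sub_le 1 _) (h.mem_le _)).trans h.one_le
  · exact (hitCount_le h.mem_le x T u).trans (by omega)

/-- The sum over all nodes here is the only source of a factor `μ` in the work for one tuple. -/
theorem cutValue {cx cT : Code} {x T : ℕ} (h : Context M B env ck cμ k μ)
    (hx : Computes M B env cx x 2) (hxB : x ≤ B) (hT : Computes M B env cT T 2) (hTB : T ≤ B) :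
    Computes M B env (Code.cutValue ck cμ cx cT) (cutValue M k μ x T)
      (13 + k * (76 + 24 * k) + μ * (29 + k * (139 + 96 * k))) := by
  have h1 := h.sq_le
  have h2 := h.μ_le_sq
  have h3 := h.k_le
  have hf := free_le (M := M) (k := k) (μ := μ) T x
  have hu := used_le h.k_le T
  refine (Computes.add
    (Computes.sum (fun u => (1 - RAM.memberCount k μ x u) * (1 - (1 - RAM.hitCount M k μ x T u)))
      (Tf := 19 + k * (139 + 96 * k)) h.one_le h.computes_μ
      (fun env' idx he u hu hidx => ?_) (by omega))
    (Computes.sum (fun j => dig 2 T j * RAM.capacity k μ j) (Tf := 66 + 24 * k) h.one_le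
      h.computes_k (fun env' idx he j hj hidx => ?_) (by omega))
    fun _ _ => by omega).mono (le_of_eq (by ring))
  · have hc := h.extend he
    refine (Computes.mul (Computes.sub (Computes.lit h.one_le)
      (hc.memberCount (hx.extend he) hxB hidx)) (Computes.sub (Computes.lit h.one_le)
        (Computes.sub (Computes.lit h.one_le)
          (hc.hitCount (hx.extend he) hxB (hT.extend he) hTB hidx hu))) ?_).mono ?_
    · exact (Nat.mul_le_mul (Nat.sub_le 1 _) (Nat.sub_le 1 _)).trans h.one_le
    · apply le_of_eq
      ring
  · have hc := h.extend he
    refine (Computes.mul (hc.bit (hT.extend he) hTB hidx hj) (hc.capacity hidx hj) ?_).mono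
      (by omega)
    exact (Finset.single_le_sum (f := fun j => dig 2 T j * RAM.capacity k μ j)
      (fun _ _ => Nat.zero_le _) (Finset.mem_range.2 hj)).trans (by omega)

theorem minCut {cx : Code} {x : ℕ} (h : Context M B env ck cμ k μ)
    (hx : Computes M B env cx x 2) (hxB : x ≤ B) :
    Computes M B env (Code.minCut ck cμ cx) (minCut M k μ x)
      (11 + k * 11 + 2 ^ k * (26 + k * (76 + 24 * k) + μ * (29 + k * (139 + 96 * k)))) := by
  refine (Computes.fold (minUpTo μ (RAM.cutValue M k μ x))
    (Tb := 19 + k * (76 + 24 * k) + μ * (29 + k * (139 + 96 * k))) h.one_le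
    (Computes.pow (Computes.lit h.two_le) h.computes_k one_le_two h.two_pow_le) h.computes_μ
    fun env' acc idx he T hT hacc hidx => ?_).mono ?_
  · have hc := h.extend he
    -- With truncated subtraction `a - (a - b)` is the minimum of `a` and `b`, so no branching is
    -- needed.
    have := Computes.sub hacc (Computes.sub hacc
      (hc.cutValue (hx.extend he) hxB hidx (hT.le.trans h.two_pow_le)))
    rw [show minUpTo μ (RAM.cutValue M k μ x) (T + 1) = minUpTo μ (RAM.cutValue M k μ x) T -
      (minUpTo μ (RAM.cutValue M k μ x) T - RAM.cutValue M k μ x T) by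
        simp only [minUpTo]
        omega]
    exact this.mono (by omega)
  · apply le_of_eq
    ring

theorem collisions {cx : Code} {x : ℕ} (h : Context M B env ck cμ k μ)
    (hx : Computes M B env cx x 2) (hxB : x ≤ B) :
    Computes M B env (Code.collisions ck cμ cx) (collisions k μ x)
      (6 + k * (16 + k * (115 + 96 * k))) := by
  have h1 := h.sq_le
  have h4 := h.k_sq_le
  refine (Computes.sum _ (Tf := 6 + k * (115 + 96 * k)) h.one_le h.computes_k
    (fun env' idx he i hi hidx => ?_) ((collisions_le x).trans (by omega))).mono
      (le_of_eq (by ring))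
  have hc := h.extend he
  refine (Computes.sum _ (Tf := 105 + 96 * k) h.one_le hidx
    (fun env'' idx' he' j hj hidx' => ?_) ?_).mono ?_
  · have hc' := hc.extend he'
    have hx' := (hx.extend he).extend he'
    exact (Computes.eqInd h.one_le (hc'.node hx' hxB (hidx.extend he') hi)
      (hc'.node hx' hxB hidx' (hj.trans hi))).mono (by omega)
  · refine le_trans (Finset.single_le_sum (f := fun i => ∑ j ∈ Finset.range i,
      if dig μ x i = dig μ x j then 1 else 0) (fun _ _ => Nat.zero_le _)
      (Finset.mem_range.2 hi)) ((collisions_le x).trans (by omega))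
  · have := Nat.mul_le_mul_right (115 + 96 * k) hi.le
    have e : 105 + 96 * k + 10 = 115 + 96 * k := by ring
    rw [e]
    omega

theorem innerCount {cx : Code} {x : ℕ} (h : Context M B env ck cμ k μ)
    (hx : Computes M B env cx x 2) (hxB : x ≤ B) :
    Computes M B env (Code.innerCount ck cμ cx) (innerCount M k μ x)
      (6 + k * (16 + k * (65 + 48 * k))) := by
  have h1 := h.sq_le
  have h4 := h.k_sq_le
  refine (Computes.sum _ (Tf := 6 + k * (65 + 48 * k)) h.one_le h.computes_k
    (fun env' idx he i hi hidx => ?_) ((innerCount_le h.mem_le x).trans (by omega))).mono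
      (le_of_eq (by ring))
  have hc := h.extend he
  refine (Computes.sum _ (Tf := 55 + 48 * k) h.one_le hc.computes_k
    (fun env'' idx' he' j hj hidx' => ?_) ?_).mono (le_of_eq (by ring))
  · have hc' := hc.extend he'
    have hx' := (hx.extend he).extend he'
    have ha := address_lt (dig_lt (b := μ) h.μ_pos x i) (dig_lt (b := μ) h.μ_pos x j)
    exact (Computes.load (Computes.add (Computes.mul (hc'.node hx' hxB (hidx.extend he') hi)
      hc'.computes_μ (by omega)) (hc'.node hx' hxB hidx' hj) fun _ _ => by omega)).mono (by omega)
  · refine le_trans (Finset.single_le_sum (f := fun i => ∑ j ∈ Finset.range k,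
      M (dig μ x i * μ + dig μ x j)) (fun _ _ => Nat.zero_le _)
      (Finset.mem_range.2 hi)) ((innerCount_le h.mem_le x).trans (by omega))

/-- A bound for the time to compute the score of one tuple, divided by the number of nodes. -/
def scoreTime (k : ℕ) : ℕ :=
  30 + k * 11 + k * (16 + k * (115 + 96 * k)) + k * (16 + k * (65 + 48 * k)) +
    2 ^ k * (26 + k * (76 + 24 * k) + (29 + k * (139 + 96 * k)))

theorem score {cx : Code} {x : ℕ} (h : Context M B env ck cμ k μ)
    (hx : Computes M B env cx x 2) (hxB : x ≤ B) :
    Computes M B env (Code.score ck cμ cx) (score M k μ x) (μ * scoreTime k) := by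
  have h1 := h.sq_le
  have h2 := h.μ_le_sq
  have h4 := h.k_sq_le
  have h5 := innerCount_le (k := k) (μ := μ) h.mem_le x
  have h6 := minCut_le (M := M) (k := k) (μ := μ) x
  have h7 := score_le (k := k) (μ := μ) h.mem_le x
  refine (Computes.mul (Computes.sub (Computes.lit h.one_le) (h.collisions hx hxB))
    (Computes.add (h.innerCount hx hxB) (Computes.mul (Computes.lit h.two_le) (h.minCut hx hxB)
      (by omega)) fun _ _ => by omega) (h7.trans (by omega))).mono ?_
  -- Terms free of `μ` are absorbed by the factor `μ ≥ 1`; with `μ = m + 1` the surplus becomes an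
  -- explicit multiple of `m` that can be dropped.
  obtain ⟨m, rfl⟩ : ∃ m, μ = m + 1 := ⟨μ - 1, by have := h.μ_pos; omega⟩
  unfold scoreTime
  generalize hP : 2 ^ k = P
  have : ∀ a b c e f : ℕ, 1 + (6 + a) + 1 + (6 + b + (1 + (11 + c + P * (26 + e + (m + 1) * f)) + 1)
      + 1) + 1 ≤ (m + 1) * (30 + c + a + b + P * (26 + e + f)) := by
    intro a b c e f
    have : (m + 1) * (30 + c + a + b + P * (26 + e + f)) =
      30 + c + a + b + P * (26 + e + (m + 1) * f) + m * (30 + c + a + b + P * (26 + e)) := by ring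
    rw [this]
    omega
  exact this _ _ _ _ _

theorem bestScore (h : Context M B env ck cμ k μ) :
    Computes M B env (Code.bestScore ck cμ) (bestScore M k μ)
      (10 + k * 12 + μ ^ k * (2 * (μ * scoreTime k) + 11)) := by
  have h1 := h.sq_le
  have h2 := h.μ_le_sq
  have h4 := h.k_sq_le
  refine (Computes.fold (fun m => (Finset.range m).sup (RAM.score M k μ))
    (Tb := 2 * (μ * scoreTime k) + 4) h.one_le
    (Computes.pow h.computes_μ h.computes_k h.μ_pos h.pow_le) (Computes.lit (Nat.zero_le _))
    fun env' acc idx he x hx hacc hidx => ?_).mono (le_of_eq (by ring))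
  have hs := (h.extend he).score hidx (hx.le.trans h.pow_le)
  have hle : (Finset.range x).sup (RAM.score M k μ) ≤ k * k + 2 * μ :=
    Finset.sup_le fun x _ => score_le h.mem_le x
  have hle' := score_le (k := k) (μ := μ) h.mem_le x
  -- With truncated subtraction `(a - b) + b` is the maximum. The score is evaluated twice, hence
  -- the factor `2` in the time.
  have := Computes.add (Computes.sub hacc hs) hs fun _ _ => by omega
  rw [Finset.range_add_one, Finset.sup_insert, show RAM.score M k μ x ⊔
    (Finset.range x).sup (RAM.score M k μ) = (Finset.range x).sup (RAM.score M k μ) -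
      RAM.score M k μ x + RAM.score M k μ x by omega]
  exact this.mono (by omega)

/-- The doubled best score is at most `2 * (k * k + 2 * μ) ≤ 6 * (μ * μ)`, which accounts for the
constant `6` in `Context`. -/
theorem starDistance (h : Context M B env ck cμ k μ) :
    Computes M B env (Code.starDistance ck cμ) (starDistance M k μ)
      (45 + k * 12 + μ * μ * 13 + μ ^ k * (2 * (μ * scoreTime k) + 11)) := by
  have h1 := h.sq_le
  have h2 := h.μ_le_sq
  have h4 := h.k_sq_le
  have h5 := bestScore_le (M := M) (k := k) (μ := μ) h.mem_le
  have h6 : k * (k - 1) ≤ k * k := Nat.mul_le_mul_left _ (Nat.sub_le _ _)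
  have h7 : ∑ a ∈ Finset.range (μ * μ), M a ≤ μ * μ := by
    simpa using sum_range_le_mul (n := μ * μ) (m := 1) fun a _ => h.mem_le a
  exact (Computes.div (Computes.sub (Computes.add (Computes.add
    (Computes.sum M (Tf := 3) h.one_le (Computes.mul h.computes_μ h.computes_μ (by omega))
      (fun env' idx he a ha hidx => hidx.load) (by omega))
    (Computes.mul h.computes_k (Computes.sub h.computes_k (Computes.lit h.one_le)) (by omega))
      fun _ _ => by omega)
    (Computes.mul (Computes.lit h.two_le) (Computes.sub h.computes_μ h.computes_k) (by omega))
      fun _ _ => by omega)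
    (Computes.mul (Computes.lit h.two_le) h.bestScore (by omega)))
    (Computes.lit h.two_le)).mono (by omega)

end Context

/-- The program: compute the distance in register `2` and move it to register `0`. -/
def starProgram : Program :=
  Code.starDistance (Code.var 0) (Code.var 1) 2 0 ++ [.const 0 0, .add 0 0 2]

theorem input_mem_le (k : ℕ) {μ : ℕ} (g : SimpleGraph (Fin μ)) (a : ℕ) :
    (input k g).mem a ≤ 1 := by
  unfold input
  dsimp only
  split_ifs <;> omega

theorem starProgram_haltsIn {k μ B : ℕ} (hk : 1 ≤ k) (hμ : k ≤ μ) (g : SimpleGraph (Fin μ))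
    (hB : 6 * (μ * μ) ≤ B) (hB₁ : μ ^ k ≤ B) (hB₂ : 2 ^ k ≤ B) :
    ∃ t ≤ 47 + k * 12 + μ * μ * 13 + μ ^ k * (2 * (μ * Context.scoreTime k) + 11), ∃ final,
      HaltsIn starProgram B t (input k g) final ∧
        final.reg 0 = starDistance (input k g).mem k μ := by
  have hctx : Context (input k g).mem B [k, μ] (Code.var 0) (Code.var 1) k μ :=
    ⟨hk, hμ, input_mem_le k g, hB, hB₁, hB₂, .var (by simp), .var (by simp)⟩
  have hμ' : μ ≤ μ * μ := Nat.le_mul_of_pos_left _ (hk.trans hμ)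
  set c := Code.starDistance (Code.var 0) (Code.var 1) 2 0 with hcode
  have hc : CodeAt starProgram 0 (c ++ [.const 0 0, .add 0 0 2]) :=
    ⟨[], [], by simp [starProgram, hcode], rfl⟩
  set M := (input k g).mem with hM
  have h1 := hctx.starDistance [k, μ] (List.prefix_refl _) starProgram 0 hc.left
  change Triple M B starProgram 0 [k, μ] _ (0 + c.length) [k, μ, starDistance M k μ] at h1
  have h2 : Triple M B starProgram (0 + c.length) [k, μ, starDistance M k μ] 1
      (0 + c.length + 1) [0, μ, starDistance M k μ] :=
    .write (a := 0) hc.right.head (fun s hs => ⟨rfl, Nat.zero_le _⟩)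
      (by simpa using set_write [k, μ, starDistance M k μ] 0 0)
  have h3 : Triple M B starProgram (0 + c.length + 1) [0, μ, starDistance M k μ] 1
      (0 + c.length + 1 + 1) [starDistance M k μ, μ, starDistance M k μ] := by
    refine .write (a := 0) (v := starDistance M k μ) hc.right.tail.head (fun s hs => ?_)
      (by simpa using set_write [0, μ, starDistance M k μ] 0 (starDistance M k μ))
    have e1 : s.reg 0 = 0 := hs.reg _ _ (by simp)
    have e2 : s.reg 2 = starDistance M k μ := hs.reg _ _ (by simp)
    exact ⟨by simp [Instr.exec, e1, e2], e2 ▸ hs.bounded.1 _⟩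
  have hs : State M B (input k g) 0 [k, μ] := by
    refine ⟨rfl, rfl, ⟨fun a => ?_, fun a => ?_⟩, fun i v hi => ?_⟩
    · simp only [input]
      split_ifs <;> omega
    · exact (input_mem_le k g a).trans hctx.one_le
    · rcases i with _ | _ | i <;> simp_all [input]
  obtain ⟨t, ht, f, hf, hsf⟩ := (h1.trans (h2.trans h3)) _ hs
  refine ⟨t, by omega, f, hf.haltsIn ?_ hsf.bounded, hsf.reg 0 _ (by simp)⟩
  rw [hsf.pc]
  simp [starProgram, ← hcode]

end RAM

/-! ### Edit paths and differing pairs -/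

section EditPath

open Classical in
/-- The ordered pairs of nodes that are linked in exactly one of two graphs. -/
noncomputable def diffPairs {V : Type*} [Fintype V] (g g' : SimpleGraph V) : Finset (V × V) :=
  Finset.univ.filter fun p => ¬ (g.Adj p.1 p.2 ↔ g'.Adj p.1 p.2)

variable {V : Type*} [Fintype V]

theorem mem_diffPairs {g g' : SimpleGraph V} {u v : V} :
    (u, v) ∈ diffPairs g g' ↔ ¬ (g.Adj u v ↔ g'.Adj u v) := by
  simp [diffPairs]

theorem EditStep.card_diffPairs_le {g g' : SimpleGraph V} (h : EditStep g g') :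
    (diffPairs g g').card ≤ 2 := by
  classical
  obtain ⟨u, v, huv, h⟩ := h
  refine (Finset.card_le_card (t := {(u, v), (v, u)}) ?_).trans Finset.card_le_two
  rintro ⟨a, b⟩ hab
  rw [mem_diffPairs] at hab
  simp only [Finset.mem_insert, Finset.mem_singleton, Prod.mk.injEq]
  by_contra hne
  apply hab
  rcases h with ⟨_, rfl⟩ | ⟨_, rfl⟩
  · simp only [SimpleGraph.sup_adj, SimpleGraph.edge_adj]
    tauto
  · simp only [SimpleGraph.sdiff_adj, SimpleGraph.edge_adj]
    tauto

/-- The triangle inequality for symmetric differences, applied along the path. -/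
theorem EditPath.card_diffPairs_le {n : ℕ} {g g' : SimpleGraph V} (h : EditPath n g g') :
    (diffPairs g g').card ≤ 2 * n := by
  classical
  induction h with
  | refl g => simp [diffPairs]
  | @step n g g' g'' hs _ ih =>
    have h1 : diffPairs g g'' ⊆ diffPairs g g' ∪ diffPairs g' g'' := by
      rintro ⟨a, b⟩ hab
      rw [Finset.mem_union, mem_diffPairs, mem_diffPairs]
      rw [mem_diffPairs] at hab
      tauto
    have h2 := (Finset.card_le_card h1).trans (Finset.card_union_le _ _)
    have h3 := hs.card_diffPairs_le
    omega

/-- Toggling the link `uv` removes exactly its two orientations from the set of differing pairs.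
Iterated, this gives a path that meets the lower bound `EditPath.card_diffPairs_le`. -/
theorem exists_editStep_of_diff {g g' : SimpleGraph V} {u v : V} (h : (u, v) ∈ diffPairs g g') :
    ∃ g₁, EditStep g g₁ ∧ (diffPairs g₁ g').card + 2 = (diffPairs g g').card := by
  classical
  have huv : u ≠ v := by
    rintro rfl
    simp [mem_diffPairs] at h
  have hcard : ({(u, v), (v, u)} : Finset (V × V)).card = 2 :=
    Finset.card_pair fun e => huv (Prod.mk.inj e).1
  have hsub : ({(u, v), (v, u)} : Finset (V × V)) ⊆ diffPairs g g' := by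
    intro p hp
    rw [Finset.mem_insert, Finset.mem_singleton] at hp
    rcases hp with rfl | rfl
    · exact h
    · rw [mem_diffPairs] at h ⊢
      rwa [g.adj_comm, g'.adj_comm]
  have key : ∀ g₁ : SimpleGraph V, (∀ a b, g₁.Adj a b ↔
      (if (a, b) = (u, v) ∨ (a, b) = (v, u) then ¬ g.Adj a b else g.Adj a b)) →
      (diffPairs g₁ g').card + 2 = (diffPairs g g').card := by
    intro g₁ hg₁
    have : diffPairs g₁ g' = diffPairs g g' \ {(u, v), (v, u)} := by
      ext ⟨a, b⟩
      rw [Finset.mem_sdiff, Finset.mem_insert, Finset.mem_singleton, mem_diffPairs, mem_diffPairs,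
        hg₁]
      split_ifs with hab
      · have : (a, b) ∈ diffPairs g g' := hsub (by simpa using hab)
        rw [mem_diffPairs] at this
        tauto
      · tauto
    rw [this, Finset.card_sdiff_of_subset hsub, hcard]
    have := Finset.card_le_card hsub
    omega
  by_cases hg : g.Adj u v
  · refine ⟨g \ SimpleGraph.edge u v, ⟨u, v, huv, .inr ⟨hg, rfl⟩⟩, key _ fun a b => ?_⟩
    simp only [SimpleGraph.sdiff_adj, SimpleGraph.edge_adj, Prod.mk.injEq]
    split_ifs with hab
    · rcases hab with ⟨rfl, rfl⟩ | ⟨rfl, rfl⟩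
      · simp [hg, huv]
      · simp [hg.symm, huv.symm]
    · tauto
  · refine ⟨g ⊔ SimpleGraph.edge u v, ⟨u, v, huv, .inl ⟨hg, rfl⟩⟩, key _ fun a b => ?_⟩
    simp only [SimpleGraph.sup_adj, SimpleGraph.edge_adj, Prod.mk.injEq]
    split_ifs with hab
    · rcases hab with ⟨rfl, rfl⟩ | ⟨rfl, rfl⟩
      · simp [hg, huv]
      · simpa [huv.symm] using fun h' => hg (SimpleGraph.Adj.symm h')
    · tauto

theorem exists_editPath (g g' : SimpleGraph V) :
    ∃ n, EditPath n g g' ∧ 2 * n = (diffPairs g g').card := by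
  induction hd : (diffPairs g g').card using Nat.strong_induction_on generalizing g with
  | _ d ih =>
    rcases (diffPairs g g').eq_empty_or_nonempty with h | ⟨⟨u, v⟩, h⟩
    · have : g = g' := by
        ext a b
        by_contra hab
        have := mem_diffPairs.2 hab
        simp [h] at this
      subst this
      exact ⟨0, .refl g, by simp [← hd, h]⟩
    · obtain ⟨g₁, hs, hc⟩ := exists_editStep_of_diff h
      obtain ⟨n, hn, hn'⟩ := ih _ (by omega) g₁ rfl
      exact ⟨n + 1, .step hs hn, by omega⟩

end EditPath

/-! ### Stars as labellings -/

/-- The pattern of a `k`-star: the vertex `inl j` stands for centre `j`, and the vertex `inr j` for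
the leaves of centre `j`. -/
def starPattern (k : ℕ) : SimpleGraph (Fin k ⊕ Fin k) where
  Adj
    | .inl i, .inl j => i ≠ j
    | .inl i, .inr j => i = j
    | .inr i, .inl j => i = j
    | .inr _, .inr _ => False
  symm := ⟨by rintro (i | i) (j | j) h <;> first | exact h.elim | exact Ne.symm h | exact Eq.symm h⟩
  loopless := ⟨by rintro (i | i) h <;> first | exact h rfl | exact h.elim⟩

/-- The number of nodes with a given label in a `k`-star on `μ` nodes. -/
def starFibre (k μ : ℕ) : Fin k ⊕ Fin k → ℕ :=
  Sum.elim (fun _ => 1) fun j => RAM.capacity k μ j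

/-- A labelling of `μ` nodes by the pattern of a `k`-star with the right number of nodes for each
label. -/
def IsStarLabel {k μ : ℕ} (lab : Fin μ → Fin k ⊕ Fin k) : Prop :=
  ∀ s, (Finset.univ.filter fun u => lab u = s).card = starFibre k μ s

theorem capacity_eq (k μ j : ℕ) :
    RAM.capacity k μ j = (μ - k) / k + if j < (μ - k) % k then 1 else 0 := by
  unfold RAM.capacity
  split_ifs <;> omega

theorem sum_capacity {k : ℕ} (hk : 1 ≤ k) (μ : ℕ) :
    ∑ j : Fin k, RAM.capacity k μ j = μ - k := by
  simp only [capacity_eq, Finset.sum_add_distrib, Finset.sum_const, Finset.card_univ,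
    Fintype.card_fin, smul_eq_mul, Finset.sum_boole, Fin.card_filter_val_lt, Nat.cast_id]
  rw [min_eq_right (Nat.mod_lt _ hk).le]
  exact Nat.div_add_mod _ _

/-- Values that differ by at most one are all `q` or `q + 1`, where `q` is the minimum. The minimum
is attained, so fewer than `k` of them are `q + 1`, and uniqueness of division with remainder
identifies `q` and their number. The permutation puts the larger values first, as in `capacity`. -/
theorem exists_perm_eq_capacity {k μ : ℕ} (hk : 1 ≤ k) (l : Fin k → ℕ)
    (hl : ∀ i j, l i ≤ l j + 1) (hsum : ∑ j, l j = μ - k) :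
    ∃ σ : Equiv.Perm (Fin k), ∀ j, l (σ j) = RAM.capacity k μ j := by
  have : Nonempty (Fin k) := ⟨⟨0, hk⟩⟩
  obtain ⟨j₀, hj₀⟩ := Finite.exists_min l
  have hval : ∀ j, l j = l j₀ + if l j = l j₀ + 1 then 1 else 0 := by
    intro j
    have := hl j j₀
    have := hj₀ j
    split_ifs <;> omega
  have hs : μ - k = k * l j₀ + (Finset.univ.filter fun j => l j = l j₀ + 1).card := by
    rw [← hsum, Finset.sum_congr rfl fun j _ => hval j]
    simp [Finset.sum_add_distrib]
  have hlt : (Finset.univ.filter fun j => l j = l j₀ + 1).card < k := by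
    have : (Finset.univ.filter fun j => l j = l j₀ + 1) ⊂ Finset.univ :=
      Finset.filter_ssubset.2 ⟨j₀, Finset.mem_univ _, by omega⟩
    simpa using Finset.card_lt_card this
  have hq : (μ - k) / k = l j₀ := by
    rw [hs, Nat.mul_add_div hk, Nat.div_eq_of_lt hlt, add_zero]
  have hr : (μ - k) % k = (Finset.univ.filter fun j => l j = l j₀ + 1).card := by
    rw [hs, Nat.mul_add_mod, Nat.mod_eq_of_lt hlt]
  have hc : Fintype.card {j : Fin k // (j : ℕ) < (μ - k) % k} =
      Fintype.card {j : Fin k // l j = l j₀ + 1} := by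
    rw [Fintype.card_subtype, Fintype.card_subtype, Fin.card_filter_val_lt, ← hr,
      min_eq_right (Nat.mod_lt _ hk).le]
  let e := Fintype.equivOfCardEq hc
  refine ⟨e.extendSubtype, fun j => ?_⟩
  rw [capacity_eq, hq]
  split_ifs with hj
  · exact e.extendSubtype_mem j hj
  · have := e.extendSubtype_not_mem j hj
    rw [hval, if_neg this]

/-- The centres are numbered so that their leaf counts match the capacities in order; a leaf
inherits the number of its unique centre. -/
theorem IsKStar.exists_label {k μ : ℕ} (hk : 1 ≤ k) {h : SimpleGraph (Fin μ)}
    (hh : IsKStar k h) :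
    ∃ lab : Fin μ → Fin k ⊕ Fin k, IsStarLabel lab ∧ h = (starPattern k).comap lab := by
  classical
  obtain ⟨S, hS, hcc, hll, hlc, hbal⟩ := hh
  choose! c hc hcu using hlc
  let e₀ : Fin k ≃ S := (S.equivFinOfCardEq hS).symm
  let l : Fin k → ℕ := fun j => (Finset.univ.filter fun u => u ∉ S ∧ h.Adj (e₀ j) u).card
  have hl : ∀ i j, l i ≤ l j + 1 := by
    intro i j
    have := hbal _ (e₀ i).2 _ (e₀ j).2
    rw [Set.ncard_eq_toFinset_card', Set.ncard_eq_toFinset_card'] at this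
    simpa [l] using this
  have hadj : ∀ u, u ∉ S → ∀ d ∈ S, (h.Adj d u ↔ c u = d) := by
    intro u hu d hd
    constructor
    · intro hdu
      exact (hcu u hu d ⟨hd, hdu⟩).symm
    · rintro rfl
      exact (hc u hu).2
  have hsum : ∑ j, l j = μ - k := by
    have h1 : (Finset.univ.filter fun u => u ∉ S).card = μ - k := by
      have : (Finset.univ.filter fun u => u ∉ S) = Sᶜ := by
        ext
        simp
      rw [this, Finset.card_compl, hS, Fintype.card_fin]
    rw [← h1, Finset.card_eq_sum_card_fiberwise (f := c) (t := S)
      (fun u hu => (hc u (by simpa using hu)).1), ← Finset.sum_coe_sort S, ← e₀.sum_comp]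
    refine Finset.sum_congr rfl fun j _ => ?_
    simp only [l, Finset.filter_filter]
    congr 1
    ext u
    simp only [Finset.mem_filter, Finset.mem_univ, true_and]
    exact and_congr_right fun hu => hadj u hu _ (e₀ j).2
  obtain ⟨σ, hσ⟩ := exists_perm_eq_capacity hk l hl hsum
  let e : Fin k ≃ S := σ.trans e₀
  let lab : Fin μ → Fin k ⊕ Fin k := fun u =>
    if hu : u ∈ S then .inl (e.symm ⟨u, hu⟩) else .inr (e.symm ⟨c u, (hc u hu).1⟩)
  have hin : ∀ u (hu : u ∈ S), lab u = .inl (e.symm ⟨u, hu⟩) := fun u hu => by simp [lab, hu]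
  have hout : ∀ u (hu : u ∉ S), lab u = .inr (e.symm ⟨c u, (hc u hu).1⟩) :=
    fun u hu => by simp [lab, hu]
  have hinl : ∀ u j, lab u = .inl j ↔ u = e j := by
    intro u j
    by_cases hu : u ∈ S
    · rw [hin u hu, Sum.inl.injEq, Equiv.symm_apply_eq, Subtype.ext_iff]
    · rw [hout u hu]
      simp only [reduceCtorEq, false_iff]
      rintro rfl
      exact hu (e j).2
  have hinr : ∀ u j, lab u = .inr j ↔ u ∉ S ∧ h.Adj (e j) u := by
    intro u j
    by_cases hu : u ∈ S
    · simp [hin u hu, hu]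
    · rw [hout u hu, Sum.inr.injEq, Equiv.symm_apply_eq, Subtype.ext_iff, hadj u hu _ (e j).2]
      simp [hu]
  refine ⟨lab, ?_, ?_⟩
  · rintro (j | j)
    · simp [hinl, starFibre, Finset.filter_eq']
    · simp only [hinr, starFibre, Sum.elim_inr]
      exact hσ j
  · ext u v
    rw [SimpleGraph.comap_adj]
    by_cases hu : u ∈ S <;> by_cases hv : v ∈ S
    · rw [hin u hu, hin v hv]
      simp only [starPattern, ne_eq, EmbeddingLike.apply_eq_iff_eq, Subtype.mk.injEq]
      exact ⟨fun h => h.ne, hcc u hu v hv⟩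
    · rw [hin u hu, hout v hv]
      simp only [starPattern, EmbeddingLike.apply_eq_iff_eq, Subtype.mk.injEq]
      rw [hadj v hv u hu, eq_comm]
    · rw [hout u hu, hin v hv]
      simp only [starPattern, EmbeddingLike.apply_eq_iff_eq, Subtype.mk.injEq]
      rw [h.adj_comm, hadj u hu v hv]
    · rw [hout u hu, hout v hv]
      simp only [starPattern, iff_false]
      exact hll u hu v hv

/-- Corresponding fibres have equal size, and a bijection that matches fibres preserves the
pulled-back adjacency. -/
theorem IsStarLabel.iso {k μ : ℕ} {lab lab' : Fin μ → Fin k ⊕ Fin k} (h : IsStarLabel lab)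
    (h' : IsStarLabel lab') :
    Nonempty ((starPattern k).comap lab ≃g (starPattern k).comap lab') := by
  have hc : ∀ s, Fintype.card {u // lab u = s} = Fintype.card {u // lab' u = s} := fun s => by
    rw [Fintype.card_subtype, Fintype.card_subtype, h s, h' s]
  let e : Fin μ ≃ Fin μ := Equiv.ofFiberEquiv fun s => Fintype.equivOfCardEq (hc s)
  have he : ∀ u, lab' (e u) = lab u := fun u => Equiv.ofFiberEquiv_map _ u
  exact ⟨⟨e, by simp [he]⟩⟩

theorem IsStarLabel.comp {k μ : ℕ} {lab : Fin μ → Fin k ⊕ Fin k} (h : IsStarLabel lab)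
    (e : Equiv.Perm (Fin μ)) : IsStarLabel (lab ∘ e) := by
  intro s
  rw [← h s]
  refine Finset.card_equiv e fun u => ?_
  simp

/-- The centres of a labelling. -/
theorem IsStarLabel.exists_centres {k μ : ℕ} {lab : Fin μ → Fin k ⊕ Fin k} (h : IsStarLabel lab) :
    ∃ c : Fin k → Fin μ, ∀ u j, lab u = .inl j ↔ u = c j := by
  have : ∀ j, ∃ c : Fin μ, ∀ u, lab u = .inl j ↔ u = c := by
    intro j
    obtain ⟨c, hc⟩ := Finset.card_eq_one.1 (h (.inl j))
    refine ⟨c, fun u => ?_⟩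
    have : u ∈ (Finset.univ.filter fun u => lab u = .inl j) ↔ u ∈ ({c} : Finset _) := by rw [hc]
    simpa using this
  choose c hc using this
  exact ⟨c, fun u j => hc j u⟩

/-! ### Counting common links -/

open Classical in
/-- The ordered pairs of nodes that are linked both in `g` and in the star with labels `lab`. -/
noncomputable def commonPairs {k μ : ℕ} (g : SimpleGraph (Fin μ)) (lab : Fin μ → Fin k ⊕ Fin k) :
    Finset (Fin μ × Fin μ) :=
  Finset.univ.filter fun p => g.Adj p.1 p.2 ∧ (starPattern k).Adj (lab p.1) (lab p.2)

open Classical in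
/-- The pairs of centres that are linked in `g`. -/
noncomputable def innerPairs {k μ : ℕ} (g : SimpleGraph (Fin μ)) (c : Fin k → Fin μ) :
    Finset (Fin k × Fin k) :=
  Finset.univ.filter fun p => g.Adj (c p.1) (c p.2)

open Classical in
/-- The leaves that are linked in `g` to the centre which the labelling assigns to them. -/
noncomputable def servedLeaves {k μ : ℕ} (g : SimpleGraph (Fin μ)) (c : Fin k → Fin μ)
    (lab : Fin μ → Fin k ⊕ Fin k) : Finset (Fin μ) :=
  Finset.univ.filter fun u => ∃ j, lab u = .inr j ∧ g.Adj u (c j)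

section Counting

variable {k μ : ℕ} {lab : Fin μ → Fin k ⊕ Fin k} {c : Fin k → Fin μ}

theorem centres_injective (hc : ∀ u j, lab u = .inl j ↔ u = c j) : Function.Injective c := by
  intro i j hij
  have h1 := (hc (c i) i).2 rfl
  have h2 := (hc (c i) j).2 hij
  exact Sum.inl.inj (h1.symm.trans h2)

/-- A common link joins two centres or joins a leaf to its assigned centre; the latter links are
counted in both orientations. -/
theorem card_commonPairs (g : SimpleGraph (Fin μ)) (hc : ∀ u j, lab u = .inl j ↔ u = c j) :
    (commonPairs g lab).card = (innerPairs g c).card + 2 * (servedLeaves g c lab).card := by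
  classical
  have hlab : ∀ j, lab (c j) = .inl j := fun j => (hc _ _).2 rfl
  have hinj := centres_injective hc
  let a : Fin k × Fin k ↪ Fin μ × Fin μ := ⟨fun p => (c p.1, c p.2), fun p q h =>
    Prod.ext (hinj (Prod.mk.inj h).1) (hinj (Prod.mk.inj h).2)⟩
  -- The value at a centre is a dummy: only leaves are used.
  let f : Fin μ → Fin μ := fun u => (lab u).elim (fun _ => u) c
  have hf : ∀ u j, lab u = .inr j → f u = c j := fun u j h => by simp [f, h]
  let b : Fin μ ↪ Fin μ × Fin μ := ⟨fun u => (u, f u), fun u v h => (Prod.mk.inj h).1⟩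
  let b' : Fin μ ↪ Fin μ × Fin μ := ⟨fun u => (f u, u), fun u v h => (Prod.mk.inj h).2⟩
  have e : commonPairs g lab = (innerPairs g c).map a ∪
      ((servedLeaves g c lab).map b ∪ (servedLeaves g c lab).map b') := by
    ext ⟨u, v⟩
    simp only [commonPairs, innerPairs, servedLeaves, Finset.mem_union, Finset.mem_map,
      Finset.mem_filter, Finset.mem_univ, true_and, a, b, b', Prod.exists]
    constructor
    · rintro ⟨hg, hp⟩
      rcases hu : lab u with i | i <;> rcases hv : lab v with j | j <;> rw [hu, hv] at hp
      · rw [hc] at hu hv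
        subst hu hv
        exact .inl ⟨i, j, hg, rfl⟩
      · obtain rfl : i = j := hp
        rw [hc] at hu
        subst hu
        exact .inr (.inr ⟨v, ⟨i, hv, hg.symm⟩, Prod.ext (hf v i hv) rfl⟩)
      · obtain rfl : i = j := hp
        rw [hc] at hv
        subst hv
        exact .inr (.inl ⟨u, ⟨i, hu, hg⟩, Prod.ext rfl (hf u i hu)⟩)
      · exact hp.elim
    · rintro (⟨i, j, hg, h⟩ | ⟨w, ⟨j, hj, hg⟩, h⟩ | ⟨w, ⟨j, hj, hg⟩, h⟩) <;>
        obtain ⟨rfl, rfl⟩ := Prod.mk.inj h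
      · refine ⟨hg, ?_⟩
        rw [hlab, hlab]
        intro hij
        exact g.loopless.irrefl (c j) ((show i = j from hij) ▸ hg)
      · simp only [f, hj, Sum.elim_inr, hlab]
        exact ⟨hg, rfl⟩
      · simp only [f, hj, Sum.elim_inr, hlab]
        exact ⟨hg.symm, rfl⟩
  rw [e, Finset.card_union_of_disjoint, Finset.card_union_of_disjoint, Finset.card_map,
    Finset.card_map, Finset.card_map, two_mul]
  · rw [Finset.disjoint_left]
    simp only [servedLeaves, Finset.mem_map, Finset.mem_filter, Finset.mem_univ, true_and, b, b']
    rintro _ ⟨u, ⟨i, hi, _⟩, rfl⟩ ⟨v, ⟨j, hj, _⟩, h⟩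
    have h1 := (Prod.mk.inj h).1
    rw [hf v j hj] at h1
    rw [← h1, hlab] at hi
    cases hi
  · rw [Finset.disjoint_left]
    simp only [innerPairs, servedLeaves, Finset.mem_map, Finset.mem_filter, Finset.mem_univ,
      true_and, a, b, b', Finset.mem_union]
    rintro _ ⟨⟨i, j⟩, _, rfl⟩ (⟨v, ⟨l, hl, _⟩, h⟩ | ⟨v, ⟨l, hl, _⟩, h⟩)
    · have h1 := (Prod.mk.inj h).1
      rw [h1, hlab] at hl
      cases hl
    · have h1 := (Prod.mk.inj h).2
      rw [h1, hlab] at hl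
      cases hl

theorem card_innerPairs_top (hc : Function.Injective c) :
    (innerPairs ⊤ c).card = k * (k - 1) := by
  classical
  have : innerPairs ⊤ c = (Finset.univ : Finset (Fin k)).offDiag := by
    ext p
    simp [innerPairs, hc.eq_iff]
  rw [this, Finset.offDiag_card]
  simp [Nat.mul_sub]

theorem card_compl_centres (hc : Function.Injective c) :
    (Finset.univ.filter fun u => ∀ j, u ≠ c j).card = μ - k := by
  classical
  have : (Finset.univ.filter fun u => ∀ j, u ≠ c j) = (Finset.univ.image c)ᶜ := by
    ext u
    simp [eq_comm]
  rw [this, Finset.card_compl, Finset.card_image_of_injective _ hc]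
  simp

theorem card_servedLeaves_top (hc : ∀ u j, lab u = .inl j ↔ u = c j) :
    (servedLeaves ⊤ c lab).card = μ - k := by
  rw [← card_compl_centres (centres_injective hc)]
  congr 1
  ext u
  simp only [servedLeaves, Finset.mem_filter, Finset.mem_univ, true_and, SimpleGraph.top_adj]
  constructor
  · rintro ⟨j, hj, _⟩ i hi
    rw [← hc, hj] at hi
    cases hi
  · intro h
    rcases hu : lab u with j | j
    · exact (h j ((hc u j).1 hu)).elim
    · exact ⟨j, rfl, h j⟩

open Classical in
-- This is `|A ∆ B| + 2 |A ∩ B| = |A| + |B|` for ordered link sets. The size of the star comes from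
-- `card_commonPairs` with `g = ⊤`, where every leaf is served.
theorem card_diffPairs_add (g : SimpleGraph (Fin μ)) (hc : ∀ u j, lab u = .inl j ↔ u = c j) :
    (diffPairs g ((starPattern k).comap lab)).card + 2 * (commonPairs g lab).card =
      (Finset.univ.filter fun p : Fin μ × Fin μ => g.Adj p.1 p.2).card + k * (k - 1) +
        2 * (μ - k) := by
  have h1 := card_commonPairs ⊤ hc
  rw [card_innerPairs_top (centres_injective hc), card_servedLeaves_top hc] at h1
  rw [add_assoc, ← h1]
  simp only [diffPairs, commonPairs, Finset.card_filter, Finset.mul_sum, ← Finset.sum_add_distrib,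
    SimpleGraph.comap_adj, SimpleGraph.top_adj]
  refine Finset.sum_congr rfl fun p _ => ?_
  by_cases h2 : g.Adj p.1 p.2 <;> by_cases h3 : (starPattern k).Adj (lab p.1) (lab p.2) <;>
    by_cases h4 : p.1 = p.2 <;> simp_all

end Counting

/-! ### Balanced assignments and cuts -/

open Classical in
/-- The capacity of the cut that belongs to the set `T` of centres. -/
noncomputable def cutCard {k μ : ℕ} (g : SimpleGraph (Fin μ)) (c : Fin k → Fin μ)
    (T : Finset (Fin k)) : ℕ :=
  (Finset.univ.filter fun u => (∀ j, u ≠ c j) ∧ ∃ j, j ∉ T ∧ g.Adj u (c j)).card +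
    ∑ j ∈ T, RAM.capacity k μ j

section Cuts

variable {k μ : ℕ} {g : SimpleGraph (Fin μ)} {lab : Fin μ → Fin k ⊕ Fin k} {c : Fin k → Fin μ}

/-- Weak duality: the centre of a served leaf lies in `T`, where capacities limit the count, or
outside `T`, and then the leaf itself is counted by the cut. -/
theorem card_servedLeaves_le_cutCard (hlab : IsStarLabel lab)
    (hc : ∀ u j, lab u = .inl j ↔ u = c j) (T : Finset (Fin k)) :
    (servedLeaves g c lab).card ≤ cutCard g c T := by
  classical
  have hsub : servedLeaves g c lab ⊆
      (Finset.univ.filter fun u => (∀ j, u ≠ c j) ∧ ∃ j, j ∉ T ∧ g.Adj u (c j)) ∪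
        T.biUnion fun j => Finset.univ.filter fun u => lab u = .inr j := by
    intro u hu
    simp only [servedLeaves, Finset.mem_filter, Finset.mem_univ, true_and] at hu
    obtain ⟨j, hj, hg⟩ := hu
    simp only [Finset.mem_union, Finset.mem_filter, Finset.mem_univ, true_and, Finset.mem_biUnion]
    by_cases hjT : j ∈ T
    · exact .inr ⟨j, hjT, hj⟩
    · refine .inl ⟨fun i hi => ?_, j, hjT, hg⟩
      rw [← hc, hj] at hi
      cases hi
  refine (Finset.card_le_card hsub).trans ((Finset.card_union_le _ _).trans ?_)
  refine Nat.add_le_add_left (Finset.card_biUnion_le.trans (le_of_eq ?_)) _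
  exact Finset.sum_congr rfl fun j _ => hlab (.inr j)

/-- If all cuts have capacity at least `m`, then the leaves can be assigned to the slots of the
centres, such that at least `m` of them are linked to their centre. -/
theorem exists_assignment (hk : 1 ≤ k) (hc : Function.Injective c) {m : ℕ}
    (hm : ∀ T, m ≤ cutCard g c T) :
    ∃ ψ : {u // ∀ j, u ≠ c j} ≃ (Σ j : Fin k, Fin (RAM.capacity k μ j)),
      ∃ s : Finset {u // ∀ j, u ≠ c j}, m ≤ s.card ∧ ∀ u ∈ s, g.Adj u (c (ψ u).1) := by
  classical
  have hL : Fintype.card {u // ∀ j, u ≠ c j} = μ - k := by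
    rw [Fintype.card_subtype]
    convert card_compl_centres hc
  have hSl : Fintype.card (Σ j : Fin k, Fin (RAM.capacity k μ j)) = μ - k := by
    simp [sum_capacity hk]
  -- The empty cut shows that `μ - k - m` below is a genuine difference.
  have hmn : m ≤ μ - k := by
    refine (hm ∅).trans ?_
    rw [cutCard, Finset.sum_empty, add_zero, ← card_compl_centres hc]
    exact Finset.card_le_card fun u => by
      simp only [Finset.mem_filter, Finset.mem_univ, true_and]
      exact fun h => h.1
  -- Defect form of Hall's theorem: besides the slots of its adjacent centres, every leaf may use
  -- any of `μ - k - m` dummy slots.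
  let t : {u // ∀ j, u ≠ c j} →
      Finset ((Σ j : Fin k, Fin (RAM.capacity k μ j)) ⊕ Fin (μ - k - m)) := fun u =>
    ((Finset.univ.filter fun j => g.Adj u (c j)).sigma fun _ => Finset.univ).disjSum Finset.univ
  have hall : ∀ A : Finset {u // ∀ j, u ≠ c j}, A.card ≤ (A.biUnion t).card := by
    intro A
    rcases A.eq_empty_or_nonempty with rfl | hA
    · simp
    -- The cut to test is the neighbourhood of `A`: leaves with a neighbour outside it are not in
    -- `A`, so at most `μ - k - |A|` of them are counted.
    let T : Finset (Fin k) := A.biUnion fun u => Finset.univ.filter fun j => g.Adj u (c j)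
    have h1 : (T.sigma fun j => (Finset.univ : Finset (Fin (RAM.capacity k μ j)))).disjSum
        Finset.univ ⊆ A.biUnion t := by
      intro z hz
      rw [Finset.mem_biUnion]
      rcases z with ⟨j, i⟩ | z
      · simp only [Finset.inl_mem_disjSum, Finset.mem_sigma, T, Finset.mem_biUnion,
          Finset.mem_filter, Finset.mem_univ, true_and, and_true] at hz
        obtain ⟨u, hu, huj⟩ := hz
        exact ⟨u, hu, by simp [t, huj]⟩
      · obtain ⟨u, hu⟩ := hA
        exact ⟨u, hu, by simp [t]⟩
    have h2 := Finset.card_le_card h1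
    rw [Finset.card_disjSum, Finset.card_sigma] at h2
    simp only [Finset.card_univ, Fintype.card_fin] at h2
    have h3 : (Finset.univ.filter fun u => (∀ j, u ≠ c j) ∧ ∃ j, j ∉ T ∧ g.Adj u (c j)).card +
        A.card ≤ μ - k := by
      rw [← card_compl_centres hc, ← Finset.card_map (Function.Embedding.subtype _),
        ← Finset.card_union_of_disjoint]
      · refine Finset.card_le_card fun u hu => ?_
        simp only [Finset.mem_union, Finset.mem_filter, Finset.mem_univ, true_and,
          Finset.mem_map, Function.Embedding.subtype_apply] at hu ⊢
        rcases hu with hu | ⟨v, _, rfl⟩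
        · exact hu.1
        · exact v.2
      · rw [Finset.disjoint_left]
        simp only [Finset.mem_filter, Finset.mem_univ, true_and,
          Finset.mem_map, Function.Embedding.subtype_apply]
        rintro u ⟨_, j, hj, huj⟩ ⟨v, hv, rfl⟩
        exact hj (Finset.mem_biUnion.2 ⟨v, hv, by simpa using huj⟩)
    have h4 := hm T
    rw [cutCard] at h4
    omega
  obtain ⟨φ, hφ, hφt⟩ := (Finset.all_card_le_biUnion_card_iff_exists_injective t).1 hall
  let s : Finset {u // ∀ j, u ≠ c j} := Finset.univ.filter fun u => (φ u).isLeft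
  have hs : m ≤ s.card := by
    have h1 : sᶜ.card ≤ μ - k - m := by
      have : sᶜ.card ≤ (Finset.univ.map (Function.Embedding.inr :
          Fin (μ - k - m) ↪ (Σ j : Fin k, Fin (RAM.capacity k μ j)) ⊕ _)).card := by
        refine Finset.card_le_card_of_injOn φ (fun u hu => ?_) hφ.injOn
        simp only [s, Finset.coe_compl, Finset.coe_filter, Finset.mem_univ, true_and,
          Set.mem_compl_iff, Set.mem_ofPred_eq, Bool.not_eq_true, Sum.isLeft_eq_false,
          Sum.isRight_iff] at hu
        obtain ⟨y, hy⟩ := hu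
        simp [hy]
      simpa using this
    rw [Finset.card_compl, hL] at h1
    omega
  have hne : ∀ u : {u // ∀ j, u ≠ c j}, Nonempty (Σ j : Fin k, Fin (RAM.capacity k μ j)) :=
    fun u => Fintype.card_pos_iff.1 (by rw [hSl, ← hL]; exact Fintype.card_pos_iff.2 ⟨u⟩)
  -- Leaves on dummies get an arbitrary slot. Only the restriction to `s` is kept; it extends to a
  -- bijection because there are as many slots as leaves.
  let f : {u // ∀ j, u ≠ c j} → (Σ j : Fin k, Fin (RAM.capacity k μ j)) := fun u =>
    (φ u).elim id fun _ => (hne u).some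
  have hf : ∀ u ∈ s, φ u = .inl (f u) := by
    intro u hu
    simp only [s, Finset.mem_filter, Finset.mem_univ, true_and, Sum.isLeft_iff] at hu
    obtain ⟨y, hy⟩ := hu
    simp [f, hy]
  obtain ⟨ψ, hψ⟩ := Finset.exists_equiv_extend_of_card_eq (t := Finset.univ) (s := s) (f := f)
    (by rw [hL, Finset.card_univ, hSl]) (Finset.subset_univ _) (by
      intro u hu v hv huv
      apply hφ
      rw [hf u hu, hf v hv, huv])
  refine ⟨ψ.trans (Equiv.subtypeUnivEquiv fun x => Finset.mem_univ x), s, hs, fun u hu => ?_⟩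
  have h1 := hφt u
  rw [hf u hu] at h1
  simp only [t, Finset.inl_mem_disjSum, Finset.mem_sigma, Finset.mem_filter, Finset.mem_univ,
    true_and, and_true] at h1
  simpa [hψ u hu] using h1

/-- Each leaf is labelled by the centre that owns its slot; bijectivity of the slot assignment gives
the exact fibre sizes. -/
theorem exists_label_of_le_cutCard (hk : 1 ≤ k) (hc : Function.Injective c) {m : ℕ}
    (hm : ∀ T, m ≤ cutCard g c T) :
    ∃ lab : Fin μ → Fin k ⊕ Fin k, IsStarLabel lab ∧ (∀ u j, lab u = .inl j ↔ u = c j) ∧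
      m ≤ (servedLeaves g c lab).card := by
  classical
  obtain ⟨ψ, s, hs, hsg⟩ := exists_assignment hk hc hm
  let lab : Fin μ → Fin k ⊕ Fin k := fun u =>
    if hu : ∀ j, u ≠ c j then .inr (ψ ⟨u, hu⟩).1 else .inl (not_forall_not.1 hu).choose
  have hleaf : ∀ u (hu : ∀ j, u ≠ c j), lab u = .inr (ψ ⟨u, hu⟩).1 := fun u hu => by
    simp only [lab]
    rw [dif_pos hu]
  have hcentre : ∀ j, lab (c j) = .inl j := by
    intro j
    have hn : ¬ ∀ i, c j ≠ c i := fun h => h j rfl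
    simp only [lab]
    rw [dif_neg hn]
    exact congrArg _ (hc (not_forall_not.1 hn).choose_spec).symm
  have hinl : ∀ u j, lab u = .inl j ↔ u = c j := by
    intro u j
    constructor
    · intro h
      by_cases hu : ∀ j, u ≠ c j
      · rw [hleaf u hu] at h
        cases h
      · obtain ⟨i, rfl⟩ := not_forall_not.1 hu
        rw [hcentre] at h
        rw [Sum.inl.inj h]
    · rintro rfl
      exact hcentre j
  refine ⟨lab, ?_, hinl, ?_⟩
  · rintro (j | j)
    · simp [hinl, starFibre, Finset.filter_eq']
    · have : (Finset.univ.filter fun u => lab u = .inr j) =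
          (Finset.univ : Finset (Fin (RAM.capacity k μ j))).image
            fun i => (ψ.symm ⟨j, i⟩ : Fin μ) := by
        ext u
        simp only [Finset.mem_filter, Finset.mem_univ, true_and, Finset.mem_image]
        constructor
        · intro h
          have hu : ∀ j, u ≠ c j := by
            rintro i rfl
            rw [hcentre] at h
            cases h
          rw [hleaf u hu] at h
          obtain rfl := Sum.inr.inj h
          exact ⟨(ψ ⟨u, hu⟩).2, by simp⟩
        · rintro ⟨i, rfl⟩
          rw [hleaf _ (ψ.symm ⟨j, i⟩).2]
          simp
      rw [this, Finset.card_image_of_injective _ fun i i' h => by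
        simpa using ψ.symm.injective (Subtype.ext h)]
      simp [starFibre]
  · refine hs.trans ?_
    rw [← Finset.card_map (Function.Embedding.subtype _)]
    refine Finset.card_le_card fun u hu => ?_
    simp only [Finset.mem_map, Function.Embedding.subtype_apply] at hu
    obtain ⟨v, hv, rfl⟩ := hu
    simp only [servedLeaves, Finset.mem_filter, Finset.mem_univ, true_and]
    exact ⟨_, hleaf v v.2, hsg v hv⟩

end Cuts

/-! ### The values of the algorithm in terms of the graph -/

namespace RAM

open Classical in
theorem input_mem_apply (k : ℕ) {μ : ℕ} (g : SimpleGraph (Fin μ)) (u v : Fin μ) :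
    (input k g).mem (u * μ + v) = if g.Adj u v then 1 else 0 := by
  have hiff : (∃ i j : Fin μ, (u : ℕ) * μ + v = (i : ℕ) * μ + (j : ℕ) ∧ g.Adj i j) ↔
      g.Adj u v := by
    constructor
    · rintro ⟨i, j, h, hg⟩
      have hμ : 0 < μ := u.pos
      have h1 : u = i := by
        have := congrArg (· / μ) h
        simp only [mul_comm _ μ, Nat.mul_add_div hμ, Nat.div_eq_of_lt v.2,
          Nat.div_eq_of_lt j.2, add_zero] at this
        exact Fin.ext this
      subst h1
      have h2 : v = j := Fin.ext (by omega)
      exact h2 ▸ hg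
    · exact fun h => ⟨u, v, rfl, h⟩
  simp only [input, hiff]

section Values

variable {k μ : ℕ} {g : SimpleGraph (Fin μ)} {c : Fin k → Fin μ} {x : ℕ}

theorem exists_code {b : ℕ} (c : Fin k → Fin b) :
    ∃ x < b ^ k, ∀ j : Fin k, dig b x j = c j := by
  refine ⟨finFunctionFinEquiv c, (finFunctionFinEquiv c).2, fun j => ?_⟩
  exact congrArg Fin.val (congrFun (finFunctionFinEquiv.symm_apply_apply c) j)

theorem exists_subset_code (T : Finset (Fin k)) :
    ∃ x < 2 ^ k, ∀ j : Fin k, dig 2 x j = if j ∈ T then 1 else 0 := by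
  obtain ⟨x, hx, h⟩ := exists_code fun j : Fin k => if j ∈ T then (1 : Fin 2) else 0
  refine ⟨x, hx, fun j => ?_⟩
  rw [h]
  split_ifs <;> rfl

theorem collisions_eq_zero (hx : ∀ j : Fin k, dig μ x j = c j) :
    collisions k μ x = 0 ↔ Function.Injective c := by
  simp only [collisions, Finset.sum_eq_zero_iff, Finset.mem_range, ite_eq_right_iff,
    one_ne_zero, imp_false]
  have key : ∀ i j (hi : i < k) (hj : j < k), dig μ x i = dig μ x j ↔ c ⟨i, hi⟩ = c ⟨j, hj⟩ := by
    intro i j hi hj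
    rw [hx ⟨i, hi⟩, hx ⟨j, hj⟩, Fin.ext_iff]
  constructor
  · intro h i j hij
    rcases lt_trichotomy i j with hlt | heq | hlt
    · exact (h j j.2 i hlt ((key j i j.2 i.2).2 hij.symm)).elim
    · exact heq
    · exact (h i i.2 j hlt ((key i j i.2 j.2).2 hij)).elim
  · intro h i hi j hj hij
    have := h ((key i j hi (hj.trans hi)).1 hij)
    rw [Fin.mk.injEq] at this
    omega

theorem memberCount_eq_zero (hx : ∀ j : Fin k, dig μ x j = c j) (u : Fin μ) :
    memberCount k μ x u = 0 ↔ ∀ j, u ≠ c j := by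
  rw [memberCount, Finset.sum_range]
  simp [hx, Fin.ext_iff]

theorem hitCount_eq_zero (hx : ∀ j : Fin k, dig μ x j = c j) {t : ℕ} {T : Finset (Fin k)}
    (ht : ∀ j : Fin k, dig 2 t j = if j ∈ T then 1 else 0) (u : Fin μ) :
    hitCount (input k g).mem k μ x t u = 0 ↔ ¬ ∃ j, j ∉ T ∧ g.Adj u (c j) := by
  simp only [hitCount, Finset.sum_range, hx, ht, input_mem_apply, Finset.sum_eq_zero_iff,
    Finset.mem_univ, true_imp_iff, not_exists]
  refine forall_congr' fun j => ?_
  by_cases h1 : j ∈ T <;> by_cases h2 : g.Adj u (c j) <;> simp [h1, h2]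

theorem cutValue_eq (hx : ∀ j : Fin k, dig μ x j = c j) {t : ℕ} {T : Finset (Fin k)}
    (ht : ∀ j : Fin k, dig 2 t j = if j ∈ T then 1 else 0) :
    cutValue (input k g).mem k μ x t = cutCard g c T := by
  classical
  rw [cutValue, cutCard]
  congr 1
  · rw [Finset.sum_range, Finset.card_filter]
    refine Finset.sum_congr rfl fun u _ => ?_
    have h1 := memberCount_eq_zero hx u
    have h2 := hitCount_eq_zero (g := g) hx ht u
    split_ifs with h
    · rw [h1.2 h.1]
      have : hitCount (input k g).mem k μ x t u ≠ 0 := fun h0 => h2.1 h0 h.2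
      omega
    · rw [not_and_or] at h
      rcases h with h | h
      · have : memberCount k μ x u ≠ 0 := fun h0 => h (h1.1 h0)
        rw [show 1 - memberCount k μ x u = 0 by omega, zero_mul]
      · rw [h2.2 h]
        simp
  · rw [Finset.sum_range]
    simp [ht]

theorem innerCount_eq (hx : ∀ j : Fin k, dig μ x j = c j) :
    innerCount (input k g).mem k μ x = (innerPairs g c).card := by
  classical
  simp only [innerCount, Finset.sum_range, hx, input_mem_apply, innerPairs, Finset.card_filter]
  rw [Fintype.sum_prod_type]

open Classical in
theorem sum_input_mem (k : ℕ) (g : SimpleGraph (Fin μ)) :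
    ∑ a ∈ Finset.range (μ * μ), (input k g).mem a =
      (Finset.univ.filter fun p : Fin μ × Fin μ => g.Adj p.1 p.2).card := by
  rw [Finset.sum_range, ← finProdFinEquiv.sum_comp, Finset.card_filter]
  refine Finset.sum_congr rfl fun p _ => ?_
  rw [← input_mem_apply k g, finProdFinEquiv_apply_val, add_comm, mul_comm]

/-- The centres of the labelling form one of the enumerated tuples, and weak duality bounds the
served leaves by every cut that is tried. -/
theorem commonPairs_le_bestScore {lab : Fin μ → Fin k ⊕ Fin k} (hlab : IsStarLabel lab) :
    (commonPairs g lab).card ≤ bestScore (input k g).mem k μ := by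
  obtain ⟨c, hc⟩ := hlab.exists_centres
  obtain ⟨x, hxlt, hx⟩ := exists_code c
  refine le_trans ?_ (Finset.le_sup (Finset.mem_range.2 hxlt))
  rw [score, (collisions_eq_zero hx).2 (centres_injective hc), innerCount_eq hx,
    card_commonPairs g hc, Nat.sub_zero, one_mul]
  refine Nat.add_le_add_left (Nat.mul_le_mul_left 2 (le_minUpTo ?_ fun t _ => ?_)) _
  · exact (Finset.card_le_univ _).trans_eq (Fintype.card_fin μ)
  · rw [cutValue_eq (T := Finset.univ.filter fun j => dig 2 t j = 1) hx fun j => ?_]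
    · exact card_servedLeaves_le_cutCard hlab hc _
    · have := dig_lt two_pos t j
      simp only [Finset.mem_filter, Finset.mem_univ, true_and]
      split_ifs <;> omega

/-- A nonzero score forces distinct centres. Every set of centres occurs among the codes below `2 ^
k`, so the computed minimum is below all cuts and the assignment theorem applies. -/
theorem score_le_commonPairs (hk : 1 ≤ k) (hμ : 0 < μ)
    (hpos : score (input k g).mem k μ x ≠ 0) :
    ∃ lab : Fin μ → Fin k ⊕ Fin k, IsStarLabel lab ∧
      score (input k g).mem k μ x ≤ (commonPairs g lab).card := by
  let c : Fin k → Fin μ := fun j => ⟨dig μ x j, dig_lt hμ _ _⟩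
  have hx : ∀ j : Fin k, dig μ x j = c j := fun _ => rfl
  have hcoll : collisions k μ x = 0 := by
    by_contra h
    apply hpos
    rw [score, show 1 - collisions k μ x = 0 by omega, zero_mul]
  have hc := (collisions_eq_zero hx).1 hcoll
  obtain ⟨lab, hlab, hcl, hm⟩ := exists_label_of_le_cutCard (g := g) hk hc
    (m := minCut (input k g).mem k μ x) fun T => by
      obtain ⟨t, ht, hT⟩ := exists_subset_code T
      rw [← cutValue_eq hx hT]
      exact minUpTo_le _ _ ht
  refine ⟨lab, hlab, ?_⟩
  rw [score, hcoll, innerCount_eq hx, card_commonPairs g hcl]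
  omega

theorem exists_bestScore_le (hk : 1 ≤ k) (hμ : k ≤ μ) (g : SimpleGraph (Fin μ)) :
    ∃ lab : Fin μ → Fin k ⊕ Fin k, IsStarLabel lab ∧
      bestScore (input k g).mem k μ ≤ (commonPairs g lab).card := by
  -- A zero maximum may come from a tuple with collisions, so it does not provide centres; any star
  -- labelling will do then.
  by_cases h0 : bestScore (input k g).mem k μ = 0
  · obtain ⟨h, hh⟩ := exists_isKStar hk hμ
    obtain ⟨lab, hlab, _⟩ := hh.exists_label hk
    exact ⟨lab, hlab, h0 ▸ Nat.zero_le _⟩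
  · have hne : (Finset.range (μ ^ k)).Nonempty :=
      Finset.nonempty_range_iff.2 (pow_pos (hk.trans hμ) k).ne'
    obtain ⟨x, _, hx⟩ := Finset.exists_mem_eq_sup _ hne (score (input k g).mem k μ)
    change bestScore _ _ _ = _ at hx
    rw [hx] at h0 ⊢
    exact score_le_commonPairs hk (hk.trans hμ) h0

/-- The sum in `hdiff` is the same for all star labellings, so a labelling with most common pairs
has fewest differing pairs, and half of these is the distance. -/
theorem isGraphEditDistance_starDistance (hk : 1 ≤ k) (hμ : k ≤ μ) (g h : SimpleGraph (Fin μ))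
    (hh : IsKStar k h) : IsGraphEditDistance g h (starDistance (input k g).mem k μ) := by
  obtain ⟨lab, hlab, rfl⟩ := hh.exists_label hk
  have hdiff : ∀ lab' : Fin μ → Fin k ⊕ Fin k, IsStarLabel lab' →
      (diffPairs g ((starPattern k).comap lab')).card + 2 * (commonPairs g lab').card =
        ∑ a ∈ Finset.range (μ * μ), (input k g).mem a + k * (k - 1) + 2 * (μ - k) := by
    intro lab' hlab'
    obtain ⟨c, hc⟩ := hlab'.exists_centres
    rw [card_diffPairs_add g hc, sum_input_mem]
  constructor
  · obtain ⟨lab', hlab', hle⟩ := exists_bestScore_le hk hμ g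
    obtain ⟨n, hn, hn2⟩ := exists_editPath g ((starPattern k).comap lab')
    refine ⟨_, ?_, hlab'.iso hlab⟩
    have h1 := hdiff lab' hlab'
    have h2 := commonPairs_le_bestScore (g := g) hlab'
    convert hn using 1
    rw [starDistance]
    omega
  · rintro n ⟨g', hn, ⟨e⟩⟩
    -- Transporting the labelling along the isomorphism exhibits every admissible target as a
    -- labelled star.
    have hg' : g' = (starPattern k).comap (lab ∘ e.toEquiv) := by
      ext u v
      exact e.map_rel_iff.symm
    have hlab' := hlab.comp e.toEquiv
    have h1 := hdiff _ hlab'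
    rw [← hg'] at h1
    have h2 := commonPairs_le_bestScore (g := g) hlab'
    have h3 := hn.card_diffPairs_le
    rw [starDistance]
    omega

end Values

end RAM

/-! ### The explicit constants -/

theorem theorem3 :
    ∃ P : RAM.Program, ∀ k : ℕ, 1 ≤ k →
      ∃ C c : ℕ, ∀ μ : ℕ, k ≤ μ → ∀ g : SimpleGraph (Fin μ),
        ∃ (t : ℕ) (final : RAM.Config),
          RAM.HaltsIn P (C * μ ^ c) t (RAM.input k g) final ∧
          t ≤ C * μ ^ (k + 2) ∧
          ∀ h : SimpleGraph (Fin μ), IsKStar k h →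
            IsGraphEditDistance g h (final.reg 0) := by
  refine ⟨RAM.starProgram, fun k hk => ?_⟩
  refine ⟨71 + k * 12 + 2 * RAM.Context.scoreTime k + 2 ^ k, k + 2, fun μ hμ g => ?_⟩
  have hμ1 : 1 ≤ μ := hk.trans hμ
  set C := 71 + k * 12 + 2 * RAM.Context.scoreTime k + 2 ^ k with hC
  set Q := μ ^ (k + 2) with hQ
  have hQ1 : 1 ≤ Q := Nat.one_le_pow _ _ hμ1
  have hQk : μ ^ k ≤ Q := Nat.pow_le_pow_right hμ1 (by omega)
  have hQk1 : μ ^ k * μ ≤ Q := by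
    rw [← pow_succ]
    exact Nat.pow_le_pow_right hμ1 (by omega)
  have hQ2 : μ * μ ≤ Q := by
    rw [← sq]
    exact Nat.pow_le_pow_right hμ1 (by omega)
  have hCQ : C * Q = 71 * Q + k * 12 * Q + 2 * (RAM.Context.scoreTime k * Q) + 2 ^ k * Q := by
    rw [hC]
    ring
  have hk12 : k * 12 ≤ k * 12 * Q := Nat.le_mul_of_pos_right _ hQ1
  have h2k : 2 ^ k ≤ 2 ^ k * Q := Nat.le_mul_of_pos_right _ hQ1
  obtain ⟨t, ht, final, hhalt, hfinal⟩ := RAM.starProgram_haltsIn (B := C * Q) hk hμ g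
    (by omega) (by omega) (by omega)
  refine ⟨t, final, hhalt, ht.trans ?_, fun h hh => ?_⟩
  · have h1 : μ ^ k * (2 * (μ * RAM.Context.scoreTime k) + 11) =
        2 * (RAM.Context.scoreTime k * (μ ^ k * μ)) + 11 * μ ^ k := by ring
    have h2 := Nat.mul_le_mul_left (RAM.Context.scoreTime k) hQk1
    omega
  · rw [hfinal]
    exact RAM.isGraphEditDistance_starDistance hk hμ g h hh
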